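/- (The $\mathbb Z^d$ Alpern Multi-tower Theorem for rectangles.) Let $d\ge 1$. For $\vec w=(w_1,\dots,w_d)$ with positive integer entries let $R_{\vec w}=\prod_{i=1}^d\{0,1,\dots,w_i-1\}\subset\mathbb Z^d$. Let $J$ be a finite or countably infinite index set, and for $j\in J$ let $\vec w^j$ be a vector of $d$ positive integers and $p_j>0$ a real number, such that for every coordinate $i=1,\dots,d$ the numbers $w^j_i$ ($j\in J$) have greatest common divisor $1$, and $\sum_{j\in J}p_j=1$. Let $T$ be a measure-preserving action of $\mathbb Z^d$ on a Lebesgue probability space $(X,\mathcal M,\mu)$ (a complete probability space isomorphic modulo null sets to the completion of a Borel probability measure on $\mathbb R$), and suppose that $T$ is free, i.e. for every $\vec v\ne 0$ one has $T^{\vec v}x\neq x$ for almost every $x$. Then there are sets $\tau^j\subset X$ ($j\in J$) such that: 1. each $\tau^j$ is a Rohlin tower of shape $R_{\vec w^j}$, i.e. $\tau^j=\bigcup_{\vec v\in R_{\vec w^j}}T^{\vec v}F_j$ for some $F_j\in\mathcal M$ whose translates $T^{\vec v}F_j$, $\vec v\in R_{\vec w^j}$, are pairwise disjoint; 2. $\mu(\tau^j)=p_j$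 for every $j$; 3. $\tau^j\cap\tau^{j'}=\emptyset$ whenever $j\ne j'$; 4. $\bigcup_{j}\tau^j=X$ up to a null set, and $\bigcup_j\tau^j=X$ exactly if $T^{\vec v}x\ne x$ holds for every $\vec v\ne0$ and every $x\in X$. -/

import Mathlib

open MeasureTheory

/-- `(X, μ)` is a Lebesgue probability space: a complete probability space that is isomorphic
modulo null sets to the completion of a Borel probability measure on the real line. (Every
standard Borel space is Borel isomorphic to a Borel subset of `ℝ`, so `ℝ` is no restriction;
atoms are allowed.) -/
structure IsLebesgueProbabilitySpace {X : Type*} [MeasurableSpace X] (μ : Measure X) : Prop where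
  isProbabilityMeasure : IsProbabilityMeasure μ
  isComplete : μ.IsComplete
  exists_iso_mod_zero : ∃ ν : Measure ℝ, IsProbabilityMeasure ν ∧
    ∃ (f : X → NullMeasurableSpace ℝ ν) (g : NullMeasurableSpace ℝ ν → X),
      MeasurePreserving f μ ν.completion ∧ MeasurePreserving g ν.completion μ ∧
      (∀ᵐ x ∂μ, g (f x) = x) ∧ (∀ᵐ y ∂ν.completion, f (g y) = y)

/-- The rectangle `∏ i, {0, …, w i - 1}` in `ℤ ^ d`. -/
def latticeRectangle {d : ℕ} (w : Fin d → ℕ) : Set (Fin d → ℤ) :=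
  {v | ∀ i, 0 ≤ v i ∧ v i < (w i : ℤ)}

/-- `τ` is a Rohlin tower of shape `latticeRectangle w` for the given action of `ℤ ^ d`: the
disjoint union of the translates, by the vectors of the rectangle, of a measurable set `F`
(the base). -/
def IsRohlinTower {d : ℕ} {X : Type*} [MeasurableSpace X] [AddAction (Fin d → ℤ) X]
    (w : Fin d → ℕ) (τ : Set X) : Prop :=
  ∃ F : Set X, MeasurableSet F ∧
    (∀ u ∈ latticeRectangle w, ∀ v ∈ latticeRectangle w, u ≠ v →
      Disjoint ((fun x : X => u +ᵥ x) '' F) ((fun x : X => v +ᵥ x) '' F)) ∧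
    τ = ⋃ v ∈ latticeRectangle w, (fun x : X => v +ᵥ x) '' F

/-! Since the sides have gcd 1 in each coordinate, finitely many shapes, indexed by a finset `J`,
already have sides that generate all large integers in every coordinate
(`exists_finset_closure_of_gcd`). Hence the gap left in a large cube by smaller cubes that are well
separated and far from its boundary can be tiled exactly by shapes from `J`, provided that the sides
of all these cubes are multiples of a common multiple `K` of the sides in `J`
(`exists_isTiling_gap`).

The indices are split into finite blocks `I m`, the first containing `J`, and cube sides `N m` are
chosen that grow fast and are divisible by `K` and by all sides of the shapes in `I m`. By the
Rohlin lemma (`exists_tower_cube`), cubes of side `N m` fill nearly all of the space. At stage `m` a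
portion of measure `ρ m` of these cubes is reserved and kept whole. In the others, the cubes of the
previous stage lying deep inside keep their subdivision, and the gaps are tiled by shapes from `J`
(`IsCubeTiling.exists_extension`). A tile can be destroyed only near the boundary of the new cubes,
inside a newly reserved cube or outside the tower. These losses are summable, so by Borel–Cantelli
the tiles that are eventually permanent cover almost everything (`exists_limit_packing`).

The limit consists of tiles of shapes in `J`, of total measure at most a lower bound `δ` of the `p
j` on `J`, and of cubes of side `N m` which, for `m ≥ 1`, cover at least the mass required by block
`m`. Cutting these cubes into rectangles of block `m`, with the surplus going to one shape `j₀ ∈ J`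
that divides every cube, gives exactly the prescribed measures (`exists_packing_of_cubes`).
Non-atomicity allows the bases to be split in any proportion.

Finally, if the action is free everywhere, the orbits meeting the uncovered set form an invariant
null set, which is retiled by choosing one point per orbit; completeness makes the result measurable
(`exists_packing_iUnion_eq_univ`). -/

/-- The union of the translates of `F` by the vectors of the rectangle of shape `w`. -/
def tower {d : ℕ} {X : Type*} [AddAction (Fin d → ℤ) X] (w : Fin d → ℕ) (F : Set X) : Set X :=
  ⋃ v ∈ latticeRectangle w, (fun x : X => v +ᵥ x) '' F

/-- The rectangles of shapes `sh s` based at the points of `F s` are pairwise disjoint. -/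
def IsPacking {d : ℕ} {X S : Type*} [AddAction (Fin d → ℤ) X] (sh : S → Fin d → ℕ)
    (F : S → Set X) : Prop :=
  ∀ s, ∀ x ∈ F s, ∀ s', ∀ y ∈ F s', ∀ u ∈ latticeRectangle (sh s),
    ∀ v ∈ latticeRectangle (sh s'), u +ᵥ x = v +ᵥ y → s = s' ∧ u = v

/-- The rectangles of shapes `sh s` based at the points of `F s` form a partition of `A`. -/
structure IsTiling {d : ℕ} {X S : Type*} [AddAction (Fin d → ℤ) X] (sh : S → Fin d → ℕ)
    (F : S → Set X) (A : Set X) : Prop where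
  packing : IsPacking sh F
  cover : ⋃ s, tower (sh s) (F s) = A

/-- Translates of the points of `F` by distinct vectors of the rectangle of shape `w` differ. -/
def IsSeparated {d : ℕ} {X : Type*} [AddAction (Fin d → ℤ) X] (w : Fin d → ℕ)
    (F : Set X) : Prop :=
  ∀ x ∈ F, ∀ y ∈ F, ∀ u ∈ latticeRectangle w, ∀ v ∈ latticeRectangle w,
    u +ᵥ x = v +ᵥ y → u = v

/-! ### Calculus of packings and tilings -/

section Tiling

variable {d : ℕ} {X S : Type*} [AddAction (Fin d → ℤ) X] {sh : S → Fin d → ℕ}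

lemma mem_tower {w : Fin d → ℕ} {F : Set X} {x : X} :
    x ∈ tower w F ↔ ∃ v ∈ latticeRectangle w, ∃ y ∈ F, v +ᵥ y = x := by
  simp [tower]

lemma zero_mem_latticeRectangle {w : Fin d → ℕ} (hw : ∀ i, 0 < w i) :
    (0 : Fin d → ℤ) ∈ latticeRectangle w := fun i => by simpa using hw i

lemma latticeRectangle_mono {w w' : Fin d → ℕ} (h : ∀ i, w i ≤ w' i) :
    latticeRectangle w ⊆ latticeRectangle w' := fun v hv i =>
  ⟨(hv i).1, (hv i).2.trans_le (by exact_mod_cast h i)⟩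

lemma IsSeparated.anti {w w' : Fin d → ℕ} {F F' : Set X} (h : IsSeparated w F)
    (hw : ∀ i, w' i ≤ w i) (hF : F' ⊆ F) : IsSeparated w' F' :=
  fun x hx y hy u hu v hv => h x (hF hx) y (hF hy) u (latticeRectangle_mono hw hu) v
    (latticeRectangle_mono hw hv)

lemma IsPacking.isSeparated {F : S → Set X} (h : IsPacking sh F) (s : S) :
    IsSeparated (sh s) (F s) := fun x hx y hy u hu v hv e => (h s x hx s y hy u hu v hv e).2

lemma IsPacking.anti {F F' : S → Set X} (h : IsPacking sh F) (hF : ∀ s, F' s ⊆ F s) :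
    IsPacking sh F' :=
  fun s x hx s' y hy => h s x (hF s hx) s' y (hF s' hy)

lemma IsTiling.mem_iff {F : S → Set X} {A : Set X} (h : IsTiling sh F A) {x : X} :
    x ∈ A ↔ ∃ s, ∃ u ∈ latticeRectangle (sh s), ∃ y ∈ F s, u +ᵥ y = x := by
  rw [← h.cover]
  simp [mem_tower]

lemma isTiling_of_mem_iff {F : S → Set X} {A : Set X} (h : IsPacking sh F)
    (hA : ∀ x, x ∈ A ↔ ∃ s, ∃ u ∈ latticeRectangle (sh s), ∃ y ∈ F s, u +ᵥ y = x) :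
    IsTiling sh F A := ⟨h, by ext x; simp [mem_tower, hA]⟩

lemma IsTiling.of_eq {F : S → Set X} {A B : Set X} (h : IsTiling sh F A) (e : B = A) :
    IsTiling sh F B := e ▸ h

lemma isTiling_empty : IsTiling sh (fun _ => (∅ : Set X)) ∅ :=
  isTiling_of_mem_iff (fun s x hx => hx.elim) (by simp)

lemma isTiling_iUnion {I : Type*} {F : I → S → Set X} {A : I → Set X}
    (h : ∀ i, IsTiling sh (F i) (A i)) (hA : ∀ i j x, x ∈ A i → x ∈ A j → i = j) :
    IsTiling sh (fun s => ⋃ i, F i s) (⋃ i, A i) := by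
  refine isTiling_of_mem_iff ?_ ?_
  · intro s x hx s' y hy u hu v hv e
    obtain ⟨i, hi⟩ := Set.mem_iUnion.1 hx
    obtain ⟨j, hj⟩ := Set.mem_iUnion.1 hy
    obtain rfl : i = j := hA i j (u +ᵥ x) ((h i).mem_iff.2 ⟨s, u, hu, x, hi, rfl⟩)
      ((h j).mem_iff.2 ⟨s', v, hv, y, hj, e.symm⟩)
    exact (h i).packing s x hi s' y hj u hu v hv e
  · intro x
    simp only [Set.mem_iUnion]
    constructor
    · rintro ⟨i, hi⟩
      obtain ⟨s, u, hu, y, hy, e⟩ := (h i).mem_iff.1 hi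
      exact ⟨s, u, hu, y, ⟨i, hy⟩, e⟩
    · rintro ⟨s, u, hu, y, ⟨i, hy⟩, e⟩
      exact ⟨i, (h i).mem_iff.2 ⟨s, u, hu, y, hy, e⟩⟩

lemma IsTiling.union {F F' : S → Set X} {A A' : Set X} (h : IsTiling sh F A)
    (h' : IsTiling sh F' A') (hA : Disjoint A A') :
    IsTiling sh (fun s => F s ∪ F' s) (A ∪ A') := by
  have := isTiling_iUnion (I := Bool) (F := fun b => bif b then F else F')
    (A := fun b => bif b then A else A') (sh := sh) (by simp [h, h']) (by
      have := Set.disjoint_left.1 hA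
      rintro (_ | _) (_ | _) x <;> simp <;> tauto)
  convert this using 1
  · ext s x
    simp only [Set.mem_union, Set.mem_iUnion, Bool.exists_bool, cond_true, cond_false]
    tauto
  · ext x
    simp only [Set.mem_union, Set.mem_iUnion, Bool.exists_bool, cond_true, cond_false]
    tauto

lemma isTiling_tower [DecidableEq S] {s : S} {F : Set X} (h : IsSeparated (sh s) F) :
    IsTiling sh (fun s' => if s' = s then F else ∅) (tower (sh s) F) := by
  have key : ∀ {x s'}, x ∈ (if s' = s then F else ∅ : Set X) → s' = s ∧ x ∈ F := by
    intro x s' hx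
    split_ifs at hx with h
    · exact ⟨h, hx⟩
    · exact hx.elim
  refine isTiling_of_mem_iff ?_ ?_
  · intro s₁ x hx s₂ y hy u hu v hv e
    obtain ⟨rfl, hx'⟩ := key hx
    obtain ⟨rfl, hy'⟩ := key hy
    exact ⟨rfl, h x hx' y hy' u hu v hv e⟩
  · intro x
    rw [mem_tower]
    constructor
    · rintro ⟨v, hv, y, hy, e⟩
      exact ⟨s, v, hv, y, by simpa using hy, e⟩
    · rintro ⟨s', v, hv, y, hy, e⟩
      obtain ⟨rfl, hy'⟩ := key hy
      exact ⟨v, hv, y, hy', e⟩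

/-- A tiling of a set `A` of vectors is carried to the orbit of `x` if `v ↦ v +ᵥ x` is injective
on `A`. -/
lemma IsTiling.vadd_image {t : S → Set (Fin d → ℤ)} {A : Set (Fin d → ℤ)} (h : IsTiling sh t A)
    {x : X} (hx : Set.InjOn (fun v : Fin d → ℤ => v +ᵥ x) A) :
    IsTiling sh (fun s => (fun v : Fin d → ℤ => v +ᵥ x) '' t s)
      ((fun v : Fin d → ℤ => v +ᵥ x) '' A) := by
  refine isTiling_of_mem_iff ?_ ?_
  · rintro s _ ⟨a, ha, rfl⟩ s' _ ⟨b, hb, rfl⟩ u hu v hv e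
    simp only [← add_vadd] at e
    exact h.packing s a ha s' b hb u hu v hv
      (hx (h.mem_iff.2 ⟨s, u, hu, a, ha, rfl⟩) (h.mem_iff.2 ⟨s', v, hv, b, hb, rfl⟩) e)
  · intro y
    constructor
    · rintro ⟨a, ha, rfl⟩
      obtain ⟨s, u, hu, b, hb, rfl⟩ := h.mem_iff.1 ha
      exact ⟨s, u, hu, _, ⟨b, hb, rfl⟩, by simp [← add_vadd]⟩
    · rintro ⟨s, u, hu, _, ⟨b, hb, rfl⟩, rfl⟩
      exact ⟨u + b, h.mem_iff.2 ⟨s, u, hu, b, hb, rfl⟩, by simp [add_vadd]⟩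

/-- Tilings of subsets of a rectangle, copied to the translates of the rectangle that are based
at the points of a separated set. -/
lemma isTiling_biUnion_vadd {w : Fin d → ℕ} {B : Set X} (hB : IsSeparated w B)
    {t : X → S → Set (Fin d → ℤ)} {A : X → Set (Fin d → ℤ)}
    (ht : ∀ x ∈ B, IsTiling sh (t x) (A x)) (hA : ∀ x ∈ B, A x ⊆ latticeRectangle w) :
    IsTiling sh (fun s => {y | ∃ x ∈ B, ∃ v ∈ t x s, v +ᵥ x = y})
      {y | ∃ x ∈ B, ∃ v ∈ A x, v +ᵥ x = y} := by
  have h := isTiling_iUnion (I := B) (sh := sh)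
    (F := fun x s => (fun v : Fin d → ℤ => v +ᵥ (x : X)) '' t x s)
    (A := fun x => (fun v : Fin d → ℤ => v +ᵥ (x : X)) '' A x)
    (fun x => (ht x x.2).vadd_image fun u hu v hv e =>
      hB x x.2 x x.2 u (hA x x.2 hu) v (hA x x.2 hv) e) (by
    rintro ⟨x, hx⟩ ⟨y, hy⟩ _ ⟨u, hu, rfl⟩ ⟨v, hv, e⟩
    obtain rfl := hB y hy x hx v (hA y hy hv) u (hA x hx hu) e
    exact Subtype.ext (vadd_left_cancel v e).symm)
  convert h using 1
  · ext s y
    simp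
  · ext y
    simp

/-- For cubes, differences of two vectors of the cube are exactly the vectors with entries of
absolute value less than `n`, so separation becomes a condition on return vectors. -/
lemma isSeparated_const_iff {n : ℕ} {B : Set X} : IsSeparated (fun _ : Fin d => n) B ↔
    ∀ x ∈ B, ∀ v : Fin d → ℤ, (∀ i, |v i| < n) → v +ᵥ x ∈ B → v = 0 := by
  constructor
  · intro h x hx v hv hvx
    -- The positive and negative parts of `v` both lie in the cube, and `v⁺ +ᵥ x = v⁻ +ᵥ (v +ᵥ x)`.
    have e : (fun i => max (v i) 0) = fun i => max (-v i) 0 := by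
      refine h x hx _ hvx _ (fun i => ?_) _ (fun i => ?_) ?_
      · have := abs_lt.1 (hv i); dsimp only; omega
      · have := abs_lt.1 (hv i); dsimp only; omega
      · rw [← add_vadd]
        congr 1
        funext i
        simp only [Pi.add_apply]
        omega
    funext i
    have := congrFun e i
    simp only [Pi.zero_apply] at this ⊢
    omega
  · intro h x hx y hy u hu v hv e
    have e' : (u - v) +ᵥ x = y := by
      rw [sub_eq_neg_add, add_vadd, e, neg_vadd_vadd]
    refine sub_eq_zero.1 (h x hx (u - v) (fun i => ?_) (e' ▸ hy))
    have h1 := hu i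
    have h2 := hv i
    simp only [Pi.sub_apply, abs_lt] at h1 h2 ⊢
    omega

end Tiling

/-! ### Tilings of boxes, annuli and gaps in the lattice -/

/-- The box with lower corner `a` and side lengths `ℓ`. -/
def latticeBox {d : ℕ} (a : Fin d → ℤ) (ℓ : Fin d → ℕ) : Set (Fin d → ℤ) :=
  {v | ∀ i, a i ≤ v i ∧ v i < a i + ℓ i}

section Lattice

variable {d : ℕ} {J : Type*} {w : J → Fin d → ℕ}

/-- A set that is a union of cells of a grid of rectangles of shape `w j` can be tiled. -/
lemma exists_isTiling_of_saturated (hw : ∀ j i, 0 < w j i) (j : J) (a : Fin d → ℤ)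
    {A : Set (Fin d → ℤ)}
    (hA : ∀ v v', (∀ i, (v i - a i) / (w j i : ℤ) = (v' i - a i) / (w j i : ℤ)) →
      v ∈ A → v' ∈ A) :
    ∃ t, IsTiling w t A := by
  classical
  have hpos : ∀ i, (0 : ℤ) < w j i := fun i => by exact_mod_cast hw j i
  have hdiv : ∀ {u v : Fin d → ℤ}, u ∈ latticeRectangle (w j) →
      (∀ i, (w j i : ℤ) ∣ v i - a i) → ∀ i, ((u + v) i - a i) / (w j i : ℤ) =
        (v i - a i) / (w j i : ℤ) := by
    intro u v hu hv i
    obtain ⟨q, hq⟩ := hv i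
    have : (u + v) i - a i = u i + (w j i : ℤ) * q := by
      rw [← hq]; simp only [Pi.add_apply]; ring
    rw [this, hq, Int.add_mul_ediv_left _ _ (hpos i).ne', Int.mul_ediv_cancel_left _ (hpos i).ne',
      Int.ediv_eq_zero_of_lt (hu i).1 (hu i).2, zero_add]
  -- The base consists of the lower corners of the cells contained in `A`; the cell of a point
  -- determines its corner.
  have hsep : IsSeparated (w j) {v | v ∈ A ∧ ∀ i, (w j i : ℤ) ∣ v i - a i} := by
    rintro x ⟨-, hx⟩ y ⟨-, hy⟩ u hu v hv e
    have e' : u + x = v + y := e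
    have : x = y := by
      funext i
      have h1 := hdiv hu hx i
      have h2 := hdiv hv hy i
      rw [e', h2] at h1
      have := Int.ediv_left_inj (hx i) (hy i)
      have h3 : y i - a i = x i - a i := (Int.ediv_left_inj (hy i) (hx i)).1 h1
      linarith
    subst this
    exact add_right_cancel e'
  refine ⟨_, (isTiling_tower (sh := w) hsep).of_eq ?_⟩
  ext v
  rw [mem_tower]
  constructor
  · intro hv
    refine ⟨fun i => (v i - a i) % (w j i : ℤ), fun i => ⟨Int.emod_nonneg _ (hpos i).ne',
      Int.emod_lt_of_pos _ (hpos i)⟩, fun i => a i + (w j i : ℤ) * ((v i - a i) / (w j i : ℤ)),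
      ⟨hA v _ ?_ hv, fun i => by simp⟩, ?_⟩
    · intro i
      rw [add_sub_cancel_left, Int.mul_ediv_cancel_left _ (hpos i).ne']
    · funext i
      have := Int.mul_ediv_add_emod (v i - a i) (w j i : ℤ)
      simp only [vadd_eq_add, Pi.add_apply]
      linarith
  · rintro ⟨u, hu, y, ⟨hy, hya⟩, rfl⟩
    exact hA y _ (fun i => (hdiv hu hya i).symm) hy

lemma exists_isTiling_latticeRectangle_of_dvd {w w' : Fin d → ℕ} (hw : ∀ i, 0 < w i)
    (h : ∀ i, w i ∣ w' i) :
    ∃ t, IsTiling (fun _ : Unit => w) t (latticeRectangle w') := by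
  refine exists_isTiling_of_saturated (w := fun _ : Unit => w) (fun _ => hw) () 0
    fun v v' hvv hv i => ?_
  have hr' : (0 : ℤ) < w i := by exact_mod_cast hw i
  obtain ⟨q, hq⟩ := h i
  have h1 : ∀ x : ℤ, (0 ≤ x ∧ x < (w' i : ℤ)) ↔ 0 ≤ x / (w i : ℤ) ∧ x / (w i : ℤ) < q := by
    intro x
    rw [Int.ediv_nonneg_iff_of_pos hr', Int.ediv_lt_iff_lt_mul hr', mul_comm (q : ℤ), hq]
    push_cast
    rfl
  have h2 := hvv i
  simp only [Pi.zero_apply, sub_zero] at h2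
  rw [h1, ← h2, ← h1]
  exact hv i

/-- A box whose sides are multiples of `K`, except for one that is a sum of sides of tiles. -/
lemma exists_isTiling_latticeBox (hw : ∀ j i, 0 < w j i) {K : ℕ} (hK : ∀ j i, w j i ∣ K)
    (k : Fin d) {n : ℕ} (hn : n ∈ AddSubmonoid.closure (Set.range fun j => w j k)) :
    ∀ (a : Fin d → ℤ) (ℓ : Fin d → ℕ), (∀ i, i ≠ k → K ∣ ℓ i) → ℓ k = n →
      ∃ t, IsTiling w t (latticeBox a ℓ) := by
  induction hn using AddSubmonoid.closure_induction with
  | mem n hn =>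
    obtain ⟨j, rfl⟩ := hn
    intro a ℓ hℓ hk
    refine exists_isTiling_of_saturated hw j a fun v v' h hv i => ?_
    have hpos : (0 : ℤ) < w j i := by exact_mod_cast hw j i
    have hd : w j i ∣ ℓ i := by
      by_cases hi : i = k
      · subst hi; exact hk ▸ dvd_rfl
      · exact (hK j i).trans (hℓ i hi)
    obtain ⟨q, hq⟩ := hd
    have h1 : ∀ x : ℤ, (a i ≤ x ∧ x < a i + ℓ i) ↔
        0 ≤ (x - a i) / (w j i : ℤ) ∧ (x - a i) / (w j i : ℤ) < q := by
      intro x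
      rw [Int.ediv_nonneg_iff_of_pos hpos, Int.ediv_lt_iff_lt_mul hpos, hq, mul_comm (q : ℤ)]
      push_cast
      constructor <;> rintro ⟨_, _⟩ <;> constructor <;> linarith
    rw [h1, ← h i, ← h1]
    exact hv i
  | zero =>
    intro a ℓ _ hk
    refine ⟨_, (isTiling_empty (sh := w)).of_eq ?_⟩
    refine Set.eq_empty_of_forall_notMem fun v hv => ?_
    have := hv k
    simp only [hk, Nat.cast_zero] at this
    omega
  | add n₁ n₂ _ _ ih₁ ih₂ =>
    intro a ℓ hℓ hk
    obtain ⟨t₁, h₁⟩ := ih₁ a (Function.update ℓ k n₁)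
      (fun i hi => by simpa [hi] using hℓ i hi) (by simp)
    obtain ⟨t₂, h₂⟩ := ih₂ (Function.update a k (a k + n₁)) (Function.update ℓ k n₂)
      (fun i hi => by simpa [hi] using hℓ i hi) (by simp)
    refine ⟨_, (h₁.union h₂ ?_).of_eq ?_⟩
    rotate_left
    · ext v
      simp only [latticeBox, Set.mem_ofPred_eq, Set.mem_union]
      constructor
      · intro h
        by_cases hv : v k < a k + n₁
        · left
          intro i
          by_cases hi : i = k
          · subst hi; simpa using ⟨(h i).1, hv⟩
          · simpa [hi] using h i
        · right
          intro i
          by_cases hi : i = k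
          · subst hi
            have := (h i).2
            rw [hk] at this
            push_cast at this
            simp only [Function.update_self]
            omega
          · simpa [hi] using h i
      · rintro (h | h) i <;> have := h i <;> by_cases hi : i = k
        · subst hi; simp only [Function.update_self] at this; rw [hk]; push_cast; omega
        · simpa [hi] using this
        · subst hi; simp only [Function.update_self] at this; rw [hk]; push_cast; omega
        · simpa [hi] using this
    · refine Set.disjoint_left.2 fun v h h' => ?_
      have h1 := (h k).2
      have h2 := (h' k).1
      simp only [Function.update_self] at h1 h2
      omega

/-- The part of a cube outside a smaller cube lying deep inside it. -/
lemma exists_isTiling_annulus (hw : ∀ j i, 0 < w j i) {K : ℕ} (hK : ∀ j i, w j i ∣ K) {M : ℕ}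
    (hM : ∀ i, ∀ n, M ≤ n → n ∈ AddSubmonoid.closure (Set.range fun j => w j i))
    {L N : ℕ} (hL : K ∣ L) (hN : K ∣ N) (a b : Fin d → ℤ) (hab : ∀ i, a i + M ≤ b i)
    (hba : ∀ i, b i + N + M ≤ a i + L) :
    ∃ t, IsTiling w t (latticeBox a (fun _ => L) \ latticeBox b fun _ => N) := by
  -- The annulus is split according to the first coordinate `k` in which a point leaves the inner
  -- cube, and to the side on which it leaves. Each piece is a box with sides `N` before `k` and `L`
  -- after `k`; its side in direction `k` is at least `M`, hence a sum of sides of tiles.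
  let A : Fin d × Bool → Set (Fin d → ℤ) := fun p =>
    latticeBox (fun i => if i < p.1 then b i else if i = p.1 then
        (bif p.2 then b i + N else a i) else a i)
      (fun i => if i < p.1 then N else if i = p.1 then
        (bif p.2 then (a i + L - b i - N).toNat else (b i - a i).toNat) else L)
  have hA : ∀ p, ∃ t, IsTiling w t (A p) := by
    rintro ⟨k, e⟩
    refine exists_isTiling_latticeBox hw hK k (hM k _ ?_) _ _ ?_ rfl
    · have := hab k
      have := hba k
      cases e <;> simp <;> omega
    · intro i hi
      simp only [hi, if_false]
      split_ifs
      exacts [hN, hL]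
  have hmem : ∀ k e v, v ∈ A (k, e) ↔ (∀ i < k, b i ≤ v i ∧ v i < b i + N) ∧
      (∀ i, k < i → a i ≤ v i ∧ v i < a i + L) ∧
      (bif e then b k + N ≤ v k ∧ v k < a k + L else a k ≤ v k ∧ v k < b k) := by
    intro k e v
    have h1 := hab k
    have h2 := hba k
    constructor
    · intro h
      refine ⟨fun i hi => by simpa [hi] using h i, fun i hi => by
        simpa [hi.not_gt, hi.ne'] using h i, ?_⟩
      have := h k
      cases e <;> simp at this ⊢ <;> omega
    · rintro ⟨h3, h4, h5⟩ i
      rcases lt_trichotomy i k with hi | rfl | hi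
      · simpa [hi] using h3 i hi
      · cases e <;> simp at h5 ⊢ <;> omega
      · simpa [hi.not_gt, hi.ne'] using h4 i hi
  choose t ht using hA
  refine ⟨_, (isTiling_iUnion ht ?_).of_eq ?_⟩
  rotate_left
  · ext v
    simp only [Set.mem_iUnion, Prod.exists, hmem]
    constructor
    · rintro ⟨h1, h2⟩
      have hne : {i | ¬ (b i ≤ v i ∧ v i < b i + N)}.Nonempty := by
        by_contra hne
        rw [Set.not_nonempty_iff_eq_empty] at hne
        refine h2 fun i => ?_
        by_contra hi
        exact (hne ▸ (show i ∈ {i | ¬ (b i ≤ v i ∧ v i < b i + N)} from hi) : i ∈ (∅ : Set _))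
      obtain ⟨k, hk, hmin⟩ := wellFounded_lt.has_min _ hne
      have h3 : ∀ i < k, b i ≤ v i ∧ v i < b i + N := fun i hi => by
        by_contra h; exact hmin i h hi
      have h1k := h1 k
      by_cases hvk : v k < b k
      · exact ⟨k, false, h3, fun i _ => h1 i, h1k.1, hvk⟩
      · refine ⟨k, true, h3, fun i _ => h1 i, ?_, h1k.2⟩
        by_contra h
        exact hk ⟨not_lt.1 hvk, not_le.1 h⟩
    · rintro ⟨k, e, h3, h4, h5⟩
      constructor
      · intro i
        have h1 := hab i
        have h2 := hba i
        rcases lt_trichotomy i k with hi | rfl | hi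
        · have := h3 i hi; dsimp only; omega
        · cases e <;> simp at h5 ⊢ <;> omega
        · exact h4 i hi
      · intro h
        have := h k
        cases e <;> simp at h5 this <;> omega
  · rintro ⟨k, e⟩ ⟨k', e'⟩ v h h'
    rw [hmem] at h h'
    obtain ⟨h3, h4, h5⟩ := h
    obtain ⟨h3', h4', h5'⟩ := h'
    rcases lt_trichotomy k k' with hk | rfl | hk
    · have := h3' k hk
      cases e <;> simp at h5 <;> omega
    · cases e <;> cases e' <;> simp at h5 h5' ⊢ <;> omega
    · have := h3 k' hk
      cases e' <;> simp at h5' <;> omega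

/-- The part of a cube outside any family of smaller cubes that are far from each other and from
the complement of the large cube. -/
lemma exists_isTiling_gap [Nonempty J] (hw : ∀ j i, 0 < w j i) {K : ℕ} (hK0 : 0 < K)
    (hK : ∀ j i, w j i ∣ K) {M : ℕ}
    (hM : ∀ i, ∀ n, M ≤ n → n ∈ AddSubmonoid.closure (Set.range fun j => w j i))
    {L N c : ℕ} (hL : K ∣ L) (hN : K ∣ N) (hc : K * (2 * M + 2) + M ≤ c) {P : Set (Fin d → ℤ)}
    (hP : ∀ u ∈ P, ∀ i, c ≤ u i ∧ u i + N + c ≤ L)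
    (hPP : ∀ u ∈ P, ∀ v ∈ P, (∀ i, |u i - v i| < N + 2 * c) → u = v) :
    ∃ t, IsTiling w t (latticeRectangle (fun _ : Fin d => L) \
      ⋃ u ∈ P, latticeBox u fun _ => N) := by
  obtain ⟨j⟩ := ‹Nonempty J›
  have hK0' : (0 : ℤ) < K := by exact_mod_cast hK0
  -- Each small cube is surrounded by a cube with corner `q u` in `K ℤ ^ d` and side `R`, leaving a
  -- margin of at least `M` on all sides. What lies outside these aligned cubes is a union of grid
  -- cells, and what lies between is an annulus.
  let q : (Fin d → ℤ) → Fin d → ℤ := fun u i => K * ((u i - M) / K)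
  have hq : ∀ u i, q u i ≤ u i - M ∧ u i - M < q u i + K := fun u i =>
    ⟨Int.mul_ediv_self_le hK0'.ne', by
      have := Int.lt_mul_ediv_self_add (x := u i - M) hK0'
      simpa [q] using this⟩
  have hKM : (M : ℤ) ≤ K * M := by
    have : (1 : ℤ) ≤ K := hK0'
    nlinarith [Int.natCast_nonneg M]
  have hc' : (K : ℤ) * (2 * M + 2) + M ≤ c := by exact_mod_cast hc
  set R : ℕ := N + K * (2 * M + 1) with hR
  have hR' : (R : ℤ) = N + 2 * (K * M) + K := by rw [hR]; push_cast; ring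
  have hc'' : 2 * ((K : ℤ) * M) + 2 * K + M ≤ c := by linarith
  have hKR : K ∣ R := hN.add (dvd_mul_right _ _)
  -- the surrounding aligned cubes are pairwise disjoint
  have hdisj : ∀ u ∈ P, ∀ v ∈ P, ∀ x, x ∈ latticeBox (q u) (fun _ => R) →
      x ∈ latticeBox (q v) (fun _ => R) → u = v := by
    intro u hu v hv x hx hx'
    refine hPP u hu v hv fun i => abs_lt.2 ?_
    have h1 := hx i
    have h2 := hx' i
    have h3 := hq u i
    have h4 := hq v i
    dsimp only at h1 h2
    constructor <;> linarith [Int.natCast_nonneg M]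
  have hsub : ∀ u, latticeBox u (fun _ => N) ⊆ latticeBox (q u) (fun _ => R) := by
    intro u x hx i
    have h1 := hx i
    have h3 := hq u i
    dsimp only at h1 ⊢
    constructor <;> linarith [Int.natCast_nonneg M]
  have hin : ∀ u ∈ P, latticeBox (q u) (fun _ => R) ⊆ latticeRectangle (fun _ : Fin d => L) := by
    intro u hu x hx i
    have h1 := hx i
    have h3 := hq u i
    have h4 := hP u hu i
    dsimp only at h1 ⊢
    constructor <;> linarith [Int.natCast_nonneg M]
  -- the part outside the surrounding cubes
  obtain ⟨t₀, ht₀⟩ : ∃ t, IsTiling w t (latticeRectangle (fun _ : Fin d => L) \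
      ⋃ u ∈ P, latticeBox (q u) fun _ => R) := by
    refine exists_isTiling_of_saturated hw j 0 fun v v' h hv => ?_
    have hpos : ∀ i, (0 : ℤ) < w j i := fun i => by exact_mod_cast hw j i
    have key : ∀ (m : ℕ) (a : ℤ), K ∣ m → (K : ℤ) ∣ a → ∀ i, (a ≤ v i ∧ v i < a + m) ↔
        (a ≤ v' i ∧ v' i < a + m) := by
      intro m a hm ha i
      have hi := h i
      simp only [Pi.zero_apply, sub_zero] at hi
      obtain ⟨m', rfl⟩ := (hK j i).trans hm
      obtain ⟨a', rfl⟩ := (Int.natCast_dvd_natCast.2 (hK j i)).trans ha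
      have h1 : ∀ x : ℤ, ((w j i : ℤ) * a' ≤ x ∧ x < (w j i : ℤ) * a' + ((w j i * m' : ℕ) : ℤ)) ↔
          a' ≤ x / (w j i : ℤ) ∧ x / (w j i : ℤ) < a' + m' := by
        intro x
        rw [Int.le_ediv_iff_mul_le (hpos i), Int.ediv_lt_iff_lt_mul (hpos i)]
        push_cast
        rw [mul_comm a', add_mul, mul_comm a', mul_comm (m' : ℤ)]
      rw [h1, h1, hi]
    have key' : ∀ (m : ℕ) (a : Fin d → ℤ), K ∣ m → (∀ i, (K : ℤ) ∣ a i) →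
        (v ∈ latticeBox a (fun _ => m) ↔ v' ∈ latticeBox a fun _ => m) := fun m a hm ha =>
      forall_congr' fun i => key m (a i) hm (ha i) i
    refine ⟨fun i => ?_, fun h' => hv.2 ?_⟩
    · have := (key L 0 hL (dvd_zero _) i).1 (by simpa using hv.1 i)
      simpa using this
    · simp only [Set.mem_iUnion] at h' ⊢
      obtain ⟨u, hu, h'⟩ := h'
      exact ⟨u, hu, (key' R (q u) hKR fun i => dvd_mul_right _ _).2 h'⟩
  have hann : ∀ u : P, ∃ t, IsTiling w t (latticeBox (q u) (fun _ => R) \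
      latticeBox u fun _ => N) := by
    intro u
    refine exists_isTiling_annulus hw hK hM hKR hN _ _ ?_ ?_ <;> intro i <;> have := hq u i <;>
      linarith
  choose t₁ ht₁ using hann
  refine ⟨_, (ht₀.union (isTiling_iUnion ht₁ ?_) ?_).of_eq ?_⟩
  rotate_left 2
  · ext x
    simp only [Set.mem_sdiff, Set.mem_iUnion, Set.mem_union, Subtype.exists, exists_prop]
    push Not
    constructor
    · rintro ⟨h1, h2⟩
      by_cases h3 : ∃ u ∈ P, x ∈ latticeBox (q u) fun _ => R
      · obtain ⟨u, hu, h3⟩ := h3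
        exact Or.inr ⟨u, hu, h3, h2 u hu⟩
      · exact Or.inl ⟨h1, by push Not at h3; exact h3⟩
    · rintro (⟨h1, h2⟩ | ⟨u, hu, h1, h2⟩)
      · exact ⟨h1, fun u hu h => h2 u hu (hsub u h)⟩
      · refine ⟨hin u hu h1, fun v hv h => h2 ?_⟩
        rwa [hdisj u hu v hv x h1 (hsub v h)]
  · rintro ⟨u, hu⟩ ⟨v, hv⟩ x hx hx'
    exact Subtype.ext (hdisj u hu v hv x hx.1 hx'.1)
  · refine Set.disjoint_left.2 fun x hx hx' => hx.2 ?_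
    simp only [Set.mem_iUnion, Subtype.exists] at hx' ⊢
    obtain ⟨u, hu, hx'⟩ := hx'
    exact ⟨u, hu, hx'.1⟩

end Lattice

/-! ### Measures of towers and maximal measurable packings -/

/-- The points outside `A` from which `A` can be reached by a vector of the cube of side `n`. -/
def cubeBoundary (d : ℕ) {X : Type*} [AddAction (Fin d → ℤ) X] (n : ℕ) (A : Set X) : Set X :=
  {x | x ∉ A ∧ ∃ v ∈ latticeRectangle (fun _ : Fin d => n), v +ᵥ x ∈ A}

lemma coe_piFinset_Ico {d : ℕ} (w : Fin d → ℕ) :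
    (Fintype.piFinset (fun i => Finset.Ico (0 : ℤ) (w i)) : Set (Fin d → ℤ)) =
      latticeRectangle w := by
  ext v
  simp [latticeRectangle]

lemma image_vadd_eq_preimage {d : ℕ} {X : Type*} [AddAction (Fin d → ℤ) X]
    (v : Fin d → ℤ) (F : Set X) :
    (fun x : X => v +ᵥ x) '' F = (fun x : X => -v +ᵥ x) ⁻¹' F := by
  ext x
  constructor
  · rintro ⟨y, hy, rfl⟩
    simpa using hy
  · intro hx
    exact ⟨-v +ᵥ x, hx, by simp⟩

section Measure

variable {d : ℕ} {X : Type*} [MeasurableSpace X] {μ : Measure X} [AddAction (Fin d → ℤ) X]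

lemma measurableSet_image_vadd (hT : ∀ v : Fin d → ℤ, MeasurePreserving (fun x : X => v +ᵥ x) μ μ)
    (v : Fin d → ℤ) {F : Set X} (hF : MeasurableSet F) :
    MeasurableSet ((fun x : X => v +ᵥ x) '' F) := by
  rw [image_vadd_eq_preimage]
  exact (hT _).measurable hF

lemma measureReal_image_vadd (hT : ∀ v : Fin d → ℤ, MeasurePreserving (fun x : X => v +ᵥ x) μ μ)
    (v : Fin d → ℤ) {F : Set X} (hF : MeasurableSet F) :
    μ.real ((fun x : X => v +ᵥ x) '' F) = μ.real F := by
  rw [image_vadd_eq_preimage, Measure.real, Measure.real,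
    (hT _).measure_preimage hF.nullMeasurableSet]

lemma measurableSet_tower (hT : ∀ v : Fin d → ℤ, MeasurePreserving (fun x : X => v +ᵥ x) μ μ)
    (w : Fin d → ℕ) {F : Set X} (hF : MeasurableSet F) : MeasurableSet (tower w F) :=
  MeasurableSet.biUnion (Set.to_countable _) fun v _ => measurableSet_image_vadd hT v hF

lemma measureReal_biUnion_vadd_le
    (hT : ∀ v : Fin d → ℤ, MeasurePreserving (fun x : X => v +ᵥ x) μ μ)
    (V : Finset (Fin d → ℤ)) {F : Set X} (hF : MeasurableSet F) :
    μ.real (⋃ v ∈ V, (fun x : X => v +ᵥ x) '' F) ≤ V.card * μ.real F := by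
  refine (measureReal_biUnion_finset_le V _).trans_eq ?_
  simp [measureReal_image_vadd hT _ hF]

lemma measureReal_tower [IsFiniteMeasure μ]
    (hT : ∀ v : Fin d → ℤ, MeasurePreserving (fun x : X => v +ᵥ x) μ μ)
    {w : Fin d → ℕ} {F : Set X} (hF : MeasurableSet F) (hs : IsSeparated w F) :
    μ.real (tower w F) = (∏ i, (w i : ℝ)) * μ.real F := by
  rw [tower]
  simp_rw [← coe_piFinset_Ico, Finset.mem_coe]
  rw [measureReal_biUnion_finset]
  · simp [measureReal_image_vadd hT _ hF]
  · rw [coe_piFinset_Ico]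
    intro u hu v hv huv
    refine Set.disjoint_left.2 ?_
    rintro _ ⟨x, hx, rfl⟩ ⟨y, hy, e⟩
    exact huv (hs y hy x hx v hv u hu e).symm
  · exact fun v _ => measurableSet_image_vadd hT v hF

/-- A maximal measurable packing of cubes of side `n` in the complement of `A`. -/
lemma exists_maximal_isSeparated
    (hT : ∀ v : Fin d → ℤ, MeasurePreserving (fun x : X => v +ᵥ x) μ μ)
    {f : X → ℝ} (hf : Measurable f) (hfree : ∀ v : Fin d → ℤ, v ≠ 0 → ∀ᵐ x ∂μ, f (v +ᵥ x) ≠ f x)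
    {n : ℕ} (hn : 0 < n) {A : Set X} (hA : MeasurableSet A) :
    ∃ F : Set X, MeasurableSet F ∧ IsSeparated (fun _ : Fin d => n) F ∧
      (∀ x ∈ F, ∀ v ∈ latticeRectangle (fun _ : Fin d => n), v +ᵥ x ∉ A) ∧
      ∀ᵐ x ∂μ, (∃ v ∈ latticeRectangle (fun _ : Fin d => n), v +ᵥ x ∈ A) ∨
        ∃ v : Fin d → ℤ, (∀ i, |v i| < n) ∧ v +ᵥ x ∈ F := by
  obtain ⟨q, hq⟩ := exists_surjective_nat (ℚ × ℚ)
  let V : Set (Fin d → ℤ) := {v | ∀ i, |v i| < n}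
  have hV : V.Finite := by
    refine Set.Finite.subset (Fintype.piFinset (fun _ : Fin d => Finset.Ioo (-n : ℤ) n)).finite_toSet
      fun v hv => ?_
    simpa [abs_lt] using fun i => abs_lt.1 (hv i)
  let I : ℕ → Set X := fun k => f ⁻¹' Set.Ioo ((q k).1 : ℝ) (q k).2
  have hI : ∀ k, MeasurableSet (I k) := fun k => hf measurableSet_Ioo
  -- Points that are alone in `I k` among their translates by `V`. Each `E k` is therefore separated
  -- by itself, and can be added to the packing in a single measurable greedy step.
  let E : ℕ → Set X := fun k => {x | x ∈ I k ∧ ∀ v ∈ V, v ≠ 0 → v +ᵥ x ∉ I k}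
  have hTm : ∀ v : Fin d → ℤ, Measurable fun x : X => v +ᵥ x := fun v => (hT v).measurable
  have hE : ∀ k, MeasurableSet (E k) := by
    intro k
    refine (hI k).inter (MeasurableSet.of_compl ?_)
    have : {x : X | ∀ v ∈ V, v ≠ 0 → v +ᵥ x ∉ I k}ᶜ =
        ⋃ v ∈ {v | v ∈ V ∧ v ≠ 0}, (fun x : X => v +ᵥ x) ⁻¹' I k := by
      ext x
      simp [and_assoc]
    exact this ▸ MeasurableSet.biUnion (Set.to_countable _) fun v _ => hTm v (hI k)
  let D : Set X := {x | ∀ v ∈ latticeRectangle (fun _ : Fin d => n), v +ᵥ x ∉ A}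
  have hD : MeasurableSet D := by
    refine MeasurableSet.of_compl ?_
    have : Dᶜ = ⋃ v ∈ latticeRectangle (fun _ : Fin d => n), (fun x : X => v +ᵥ x) ⁻¹' A := by
      ext x
      simp [D]
    exact this ▸ MeasurableSet.biUnion (Set.to_countable _) fun v _ => hTm v hA
  let U : ℕ → Set X := fun k => Nat.rec ∅ (fun k U =>
    U ∪ {x | (x ∈ E k ∧ x ∈ D) ∧ ∀ v ∈ V, v +ᵥ x ∉ U}) k
  have hU1 : ∀ k, U (k + 1) = U k ∪ {x | (x ∈ E k ∧ x ∈ D) ∧ ∀ v ∈ V, v +ᵥ x ∉ U k} :=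
    fun k => rfl
  have hUm : ∀ k, MeasurableSet (U k) := by
    intro k
    induction k with
    | zero => exact MeasurableSet.empty
    | succ k ih =>
      rw [hU1]
      refine ih.union (((hE k).inter hD).inter (MeasurableSet.of_compl ?_))
      have : {x : X | ∀ v ∈ V, v +ᵥ x ∉ U k}ᶜ = ⋃ v ∈ V, (fun x : X => v +ᵥ x) ⁻¹' U k := by
        ext x
        simp
      exact this ▸ MeasurableSet.biUnion (Set.to_countable _) fun v _ => hTm v ih
  have hmono : Monotone U := monotone_nat_of_le_succ fun k => hU1 k ▸ Set.subset_union_left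
  have hUD : ∀ k, U k ⊆ D := by
    intro k
    induction k with
    | zero => exact Set.empty_subset _
    | succ k ih => exact hU1 k ▸ Set.union_subset ih fun x hx => hx.1.2
  have hUsep : ∀ k, ∀ x ∈ U k, ∀ v ∈ V, v +ᵥ x ∈ U k → v = 0 := by
    intro k
    induction k with
    | zero => exact fun x hx => hx.elim
    | succ k ih =>
      intro x hx v hv hvx
      rw [hU1] at hx hvx
      have hneg : -v ∈ V := fun i => by simpa using hv i
      rcases hx with hx | hx <;> rcases hvx with hvx | hvx
      · exact ih x hx v hv hvx
      · exact (hvx.2 (-v) hneg (by simpa using hx)).elim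
      · exact (hx.2 v hv hvx).elim
      · by_contra h0
        exact hx.1.1.2 v hv h0 hvx.1.1.1
  refine ⟨⋃ k, U k, MeasurableSet.iUnion hUm, ?_, ?_, ?_⟩
  · rw [isSeparated_const_iff]
    intro x hx v hv hvx
    obtain ⟨k, hk⟩ := Set.mem_iUnion.1 hx
    obtain ⟨l, hl⟩ := Set.mem_iUnion.1 hvx
    exact hUsep (max k l) x (hmono (le_max_left _ _) hk) v hv (hmono (le_max_right _ _) hl)
  · intro x hx
    obtain ⟨k, hk⟩ := Set.mem_iUnion.1 hx
    exact hUD k hk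
  · have hall : ∀ᵐ x ∂μ, ∀ v : Fin d → ℤ, v ≠ 0 → f (v +ᵥ x) ≠ f x := by
      refine ae_all_iff.2 fun v => ?_
      by_cases hv : v = 0
      · simp [hv]
      · simpa [hv] using hfree v hv
    filter_upwards [hall] with x hx
    by_cases hxD : x ∈ D
    · right
      -- The values of `f` at the finitely many other translates form a closed set missing `f x`, so
      -- a rational interval isolates `f x` from them.
      obtain ⟨k, hk⟩ : ∃ k, x ∈ E k := by
        have hfin : ((fun v : Fin d → ℤ => f (v +ᵥ x)) '' (V \ {0})).Finite :=
          (hV.sdiff).image _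
        have hnot : f x ∉ (fun v : Fin d → ℤ => f (v +ᵥ x)) '' (V \ {0}) := by
          rintro ⟨v, hv, e⟩
          exact hx v hv.2 e
        obtain ⟨a, b, hab, habs⟩ := mem_nhds_iff_exists_Ioo_subset.1
          (hfin.isClosed.isOpen_compl.mem_nhds hnot)
        obtain ⟨a', ha1, ha2⟩ := exists_rat_btwn hab.1
        obtain ⟨b', hb1, hb2⟩ := exists_rat_btwn hab.2
        obtain ⟨k, hk⟩ := hq (a', b')
        refine ⟨k, ?_, fun v hv h0 hvx => ?_⟩
        · simp only [I, hk]
          exact ⟨ha2, hb1⟩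
        · simp only [I, hk] at hvx
          exact habs ⟨ha1.trans hvx.1, hvx.2.trans hb2⟩ ⟨v, ⟨hv, h0⟩, rfl⟩
      rcases Classical.em (∀ v : Fin d → ℤ, v ∈ V → (v +ᵥ x : X) ∉ U k) with h | h
      · exact ⟨0, fun i => by simpa using hn, Set.mem_iUnion.2 ⟨k + 1, by
          rw [zero_vadd, hU1]
          exact Or.inr ⟨⟨hk, hxD⟩, h⟩⟩⟩
      · push Not at h
        obtain ⟨v, hv, hvx⟩ := h
        exact ⟨v, hv, Set.mem_iUnion.2 ⟨k, hvx⟩⟩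
    · left
      simpa [D] using hxD

end Measure

/-! ### The Rohlin lemma for cubes -/

section Rohlin

variable {d : ℕ} {X : Type*} [MeasurableSpace X] {μ : Measure X} [AddAction (Fin d → ℤ) X]

lemma exists_mul_add_pow_le (d r n₀ : ℕ) (hr : 0 < r) {η : ℝ} (hη : 0 < η) :
    ∃ a : ℕ, 0 < a ∧ n₀ ≤ r * a ∧ ((r * a + n₀ : ℕ) : ℝ) ^ d ≤ (1 + η) * ((r * a : ℕ) : ℝ) ^ d := by
  have h1 : Filter.Tendsto (fun a : ℕ => (1 + (n₀ / r : ℝ) / a) ^ d) Filter.atTop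
      (nhds ((1 + 0) ^ d)) :=
    ((tendsto_const_div_atTop_nhds_zero_nat (n₀ / r : ℝ)).const_add 1).pow d
  rw [add_zero, one_pow] at h1
  obtain ⟨a, ha, ha1⟩ := ((h1.eventually (gt_mem_nhds (lt_add_of_pos_right 1 hη))).and
    (Filter.eventually_ge_atTop (n₀ + 1))).exists
  have hra : 0 < r * a := Nat.mul_pos hr (by omega)
  have hra' : (0 : ℝ) < ((r * a : ℕ) : ℝ) := by exact_mod_cast hra
  refine ⟨a, by omega, by nlinarith, ?_⟩
  have e : ((r * a + n₀ : ℕ) : ℝ) = (1 + (n₀ / r : ℝ) / a) * ((r * a : ℕ) : ℝ) := by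
    have h2 : (r : ℝ) ≠ 0 := by positivity
    have h3 : (a : ℝ) ≠ 0 := by
      have : 0 < a := by omega
      positivity
    push_cast
    field_simp
  rw [e, mul_pow]
  exact mul_le_mul_of_nonneg_right ha.le (by positivity)

/-- Only countably many vectors occur, so a pattern varying with the base point causes no harm as
long as each single vector is used on a measurable set. -/
lemma measurableSet_biUnion_vadd
    (hT : ∀ v : Fin d → ℤ, MeasurePreserving (fun x : X => v +ᵥ x) μ μ)
    {B : Set X} {t : X → Set (Fin d → ℤ)} (ht : ∀ v, MeasurableSet {x | x ∈ B ∧ v ∈ t x}) :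
    MeasurableSet {y | ∃ x ∈ B, ∃ v ∈ t x, v +ᵥ x = y} := by
  have : {y | ∃ x ∈ B, ∃ v ∈ t x, v +ᵥ x = y} =
      ⋃ v : Fin d → ℤ, (fun x : X => v +ᵥ x) '' {x | x ∈ B ∧ v ∈ t x} := by
    ext y
    simp only [Set.mem_ofPred_eq, Set.mem_iUnion, Set.mem_image]
    constructor
    · rintro ⟨x, hx, v, hv, e⟩
      exact ⟨v, x, ⟨hx, hv⟩, e⟩
    · rintro ⟨v, x, ⟨hx, hv⟩, e⟩
      exact ⟨x, hx, v, hv, e⟩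
  rw [this]
  exact MeasurableSet.iUnion fun v => measurableSet_image_vadd hT v (ht v)

/-- Each round packs much larger cubes, themselves subdivided into cubes of side `r`, into the
uncovered part. Maximality makes them cover about `2 ^ (-d)` of it, apart from points near the old
set `A`. The bound on `cubeBoundary` at an arbitrary scale `n₀` is carried along to keep that
exception negligible in the next round. -/
lemma exists_isTiling_cube_of_pow [IsProbabilityMeasure μ]
    (hT : ∀ v : Fin d → ℤ, MeasurePreserving (fun x : X => v +ᵥ x) μ μ)
    {f : X → ℝ} (hf : Measurable f) (hfree : ∀ v : Fin d → ℤ, v ≠ 0 → ∀ᵐ x ∂μ, f (v +ᵥ x) ≠ f x)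
    {r : ℕ} (hr : 0 < r) (k : ℕ) : ∀ {η : ℝ}, 0 < η → ∀ n₀ : ℕ, ∃ F A : Set X, MeasurableSet F ∧
      MeasurableSet A ∧ IsTiling (fun (_ : Unit) (_ : Fin d) => r) (fun _ => F) A ∧
      1 - μ.real A ≤ (1 - (1 / 2) ^ d) ^ k + η ∧ μ.real (cubeBoundary d n₀ A) ≤ η := by
  induction k with
  | zero =>
    intro η hη n₀
    refine ⟨∅, ∅, MeasurableSet.empty, MeasurableSet.empty, isTiling_empty, ?_, ?_⟩
    · simpa using hη.le
    · simpa [cubeBoundary] using hη.le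
  | succ k ih =>
    intro η hη n₀
    -- The new side `n` is fixed before the induction hypothesis is applied, so that the old set can
    -- be required to have small boundary at scale `n`.
    obtain ⟨a, ha, hna, hpow⟩ := exists_mul_add_pow_le d r n₀ hr (half_pos hη)
    set n := r * a with hn
    have hn0 : 0 < n := Nat.mul_pos hr ha
    obtain ⟨F₁, A, hF₁, hA, htil, hlarge, hbd⟩ := ih (half_pos hη) n
    obtain ⟨F₂, hF₂, hsep, hF₂A, hmax⟩ := exists_maximal_isSeparated hT hf hfree hn0 hA
    set C := tower (fun _ : Fin d => n) F₂ with hC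
    have hCm : MeasurableSet C := measurableSet_tower hT _ hF₂
    have hCreal : μ.real C = (n : ℝ) ^ d * μ.real F₂ := by
      rw [hC, measureReal_tower hT hF₂ hsep]; simp
    have hdisj : Disjoint A C := by
      refine Set.disjoint_left.2 fun x hxA hxC => ?_
      obtain ⟨v, hv, y, hy, rfl⟩ := mem_tower.1 hxC
      exact hF₂A y hy v hv hxA
    obtain ⟨t, ht⟩ := exists_isTiling_latticeRectangle_of_dvd (w := fun _ : Fin d => r)
      (w' := fun _ => n) (fun _ => hr) fun _ => dvd_mul_right r a
    have hCtil := isTiling_biUnion_vadd hsep (t := fun _ => t) (fun _ _ => ht) (fun _ _ => le_rfl)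
    have hCeq : {y | ∃ x ∈ F₂, ∃ v ∈ latticeRectangle (fun _ : Fin d => n), v +ᵥ x = y} = C := by
      ext y
      rw [hC, mem_tower]
      constructor
      · rintro ⟨x, hx, v, hv, e⟩
        exact ⟨v, hv, x, hx, e⟩
      · rintro ⟨v, hv, x, hx, e⟩
        exact ⟨x, hx, v, hv, e⟩
    rw [hCeq] at hCtil
    have hunion : μ.real (A ∪ C) = μ.real A + μ.real C := measureReal_union hdisj hCm
    have hA1 : μ.real A + μ.real C ≤ 1 := hunion ▸ measureReal_le_one
    refine ⟨F₁ ∪ {y | ∃ x ∈ F₂, ∃ v ∈ t (), v +ᵥ x = y}, A ∪ C, ?_, hA.union hCm,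
      htil.union hCtil hdisj, ?_, ?_⟩
    · refine hF₁.union (measurableSet_biUnion_vadd hT fun v => ?_)
      by_cases hv : v ∈ t ()
      · simpa [hv] using hF₂
      · simp [hv]
    · -- the new cubes cover a definite proportion of the complement of `A`
      have hcard : 1 - μ.real A ≤ η / 2 + 2 ^ d * μ.real C := by
        let V : Finset (Fin d → ℤ) := Fintype.piFinset fun _ => Finset.Ioo (-n : ℤ) n
        have hVc : (V.card : ℝ) ≤ (2 * n) ^ d := by
          have : V.card ≤ (2 * n) ^ d := by
            simp only [V, Fintype.card_piFinset, Int.card_Ioo, Finset.prod_const, Finset.card_univ,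
              Fintype.card_fin]
            exact Nat.pow_le_pow_left (by omega) d
          exact_mod_cast this
        have h1 : 1 - μ.real A = μ.real Aᶜ := by
          rw [measureReal_compl hA, probReal_univ]
        have h2 : μ.real Aᶜ ≤ μ.real (cubeBoundary d n A ∪ ⋃ v ∈ V, (fun x : X => v +ᵥ x) '' F₂) := by
          refine ENNReal.toReal_mono (measure_ne_top _ _) (measure_mono_ae ?_)
          filter_upwards [hmax] with x hx hxA
          rcases hx with hx | ⟨v, hv, hvx⟩
          · exact Or.inl ⟨hxA, hx⟩
          · refine Or.inr (Set.mem_biUnion (x := -v) ?_ ⟨_, hvx, by simp⟩)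
            simp only [V, Finset.mem_coe, Fintype.mem_piFinset, Finset.mem_Ioo]
            intro i
            have := abs_lt.1 (hv i)
            simp only [Pi.neg_apply]
            omega
        calc 1 - μ.real A ≤ _ := h1.trans_le h2
          _ ≤ _ := measureReal_union_le _ _
          _ ≤ η / 2 + (2 * n) ^ d * μ.real F₂ :=
            add_le_add hbd ((measureReal_biUnion_vadd_le hT V hF₂).trans
              (mul_le_mul_of_nonneg_right hVc measureReal_nonneg))
          _ = η / 2 + 2 ^ d * μ.real C := by rw [hCreal, mul_pow]; ring
      rw [hunion]
      have h2d : (0 : ℝ) < (1 / 2) ^ d := by positivity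
      have h2d1 : ((1 : ℝ) / 2) ^ d ≤ 1 := pow_le_one₀ (by norm_num) (by norm_num)
      have h22 : ((1 : ℝ) / 2) ^ d * 2 ^ d = 1 := by rw [← mul_pow]; norm_num
      have h3 : ((1 : ℝ) / 2) ^ d * (1 - μ.real A) ≤ (1 / 2) ^ d * (η / 2) + μ.real C := by
        calc _ ≤ ((1 : ℝ) / 2) ^ d * (η / 2 + 2 ^ d * μ.real C) :=
              mul_le_mul_of_nonneg_left hcard h2d.le
          _ = (1 / 2) ^ d * (η / 2) + ((1 / 2) ^ d * 2 ^ d) * μ.real C := by ring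
          _ = _ := by rw [h22, one_mul]
      have h4 : (1 - ((1 : ℝ) / 2) ^ d) * (1 - μ.real A) ≤
          (1 - (1 / 2) ^ d) * ((1 - (1 / 2) ^ d) ^ k + η / 2) :=
        mul_le_mul_of_nonneg_left hlarge (by linarith)
      rw [pow_succ']
      nlinarith
    -- A point of the new boundary is near `A`, or lies in a cube of `F₂` thickened by `n₀` in the
    -- negative directions but not in the cube itself. The choice of `n` makes this shell a small
    -- fraction of the cube.
    · let V : Finset (Fin d → ℤ) := (Fintype.piFinset fun _ => Finset.Ico (-n₀ : ℤ) n) \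
        Fintype.piFinset fun _ => Finset.Ico (0 : ℤ) n
      have hVc : (V.card : ℝ) = ((n + n₀ : ℕ) : ℝ) ^ d - (n : ℝ) ^ d := by
        have hsub : (Fintype.piFinset fun _ : Fin d => Finset.Ico (0 : ℤ) n) ⊆
            Fintype.piFinset fun _ : Fin d => Finset.Ico (-n₀ : ℤ) n :=
          Fintype.piFinset_subset _ _ fun i => Finset.Ico_subset_Ico_left (by omega)
        rw [Finset.cast_card_sdiff hsub]
        simp only [Fintype.card_piFinset, Int.card_Ico, Finset.prod_const, Finset.card_univ,
          Fintype.card_fin]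
        congr
        · push_cast
          congr 1
          have : ((n : ℤ) - -(n₀ : ℤ)).toNat = n + n₀ := by omega
          rw [this]
          push_cast
          rfl
        · simp
      have hsub : cubeBoundary d n₀ (A ∪ C) ⊆
          cubeBoundary d n A ∪ ⋃ v ∈ V, (fun x : X => v +ᵥ x) '' F₂ := by
        rintro x ⟨hx, v, hv, hvx⟩
        rcases hvx with hvx | hvx
        · exact Or.inl ⟨fun h => hx (Or.inl h), v, latticeRectangle_mono (fun _ => hna) hv, hvx⟩
        · obtain ⟨u, hu, y, hy, e⟩ := mem_tower.1 hvx
          have e' : (u - v) +ᵥ y = x := by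
            rw [sub_eq_neg_add, add_vadd, e, neg_vadd_vadd]
          refine Or.inr (Set.mem_biUnion (x := u - v) ?_ ⟨y, hy, e'⟩)
          simp only [V, Finset.coe_sdiff, Set.mem_sdiff, Finset.mem_coe, Fintype.mem_piFinset,
            Finset.mem_Ico]
          constructor
          · intro i
            have h1 := hu i
            have h2 := hv i
            simp only [Pi.sub_apply] at h1 h2 ⊢
            omega
          · intro h
            exact hx (Or.inr (mem_tower.2 ⟨u - v, fun i => h i, y, hy, e'⟩))
      calc μ.real (cubeBoundary d n₀ (A ∪ C)) ≤ _ := measureReal_mono hsub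
        _ ≤ _ := measureReal_union_le _ _
        _ ≤ η / 2 + (((n + n₀ : ℕ) : ℝ) ^ d - (n : ℝ) ^ d) * μ.real F₂ :=
          add_le_add hbd ((measureReal_biUnion_vadd_le hT V hF₂).trans_eq (by rw [hVc]))
        _ ≤ η / 2 + η / 2 * (n : ℝ) ^ d * μ.real F₂ := by
          have : ((n + n₀ : ℕ) : ℝ) ^ d - (n : ℝ) ^ d ≤ η / 2 * (n : ℝ) ^ d := by linarith
          gcongr
        _ ≤ η := by
          have h1 : μ.real C ≤ 1 := measureReal_le_one
          rw [mul_assoc, ← hCreal]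
          nlinarith

/-- The **Rohlin lemma** for cubes. -/
lemma exists_tower_cube [IsProbabilityMeasure μ]
    (hT : ∀ v : Fin d → ℤ, MeasurePreserving (fun x : X => v +ᵥ x) μ μ)
    {f : X → ℝ} (hf : Measurable f) (hfree : ∀ v : Fin d → ℤ, v ≠ 0 → ∀ᵐ x ∂μ, f (v +ᵥ x) ≠ f x)
    {r : ℕ} (hr : 0 < r) {ε : ℝ} (hε : 0 < ε) :
    ∃ F : Set X, MeasurableSet F ∧ IsSeparated (fun _ : Fin d => r) F ∧
      1 - ε ≤ (r : ℝ) ^ d * μ.real F := by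
  have h2d : (0 : ℝ) < (1 / 2) ^ d := by positivity
  have h2d1 : ((1 : ℝ) / 2) ^ d ≤ 1 := pow_le_one₀ (by norm_num) (by norm_num)
  obtain ⟨k, hk⟩ := exists_pow_lt_of_lt_one (half_pos hε) (y := 1 - ((1 : ℝ) / 2) ^ d)
    (by linarith)
  obtain ⟨F, A, hF, hA, htil, hlarge, -⟩ := exists_isTiling_cube_of_pow hT hf hfree hr k
    (half_pos hε) 0
  have hsep : IsSeparated (fun _ : Fin d => r) F := htil.packing.isSeparated ()
  refine ⟨F, hF, hsep, ?_⟩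
  have e : tower (fun _ : Fin d => r) F = A := by
    rw [← htil.cover]
    exact (Set.iUnion_const _).symm
  have := measureReal_tower hT hF hsep
  rw [e] at this
  simp only [Finset.prod_const, Finset.card_univ, Fintype.card_fin] at this
  linarith

/-- The measure of a tower of cubes stays large after all cubes have been shrunk by `a`. -/
lemma exists_isSeparated_add [IsProbabilityMeasure μ]
    (hT : ∀ v : Fin d → ℤ, MeasurePreserving (fun x : X => v +ᵥ x) μ μ)
    {f : X → ℝ} (hf : Measurable f) (hfree : ∀ v : Fin d → ℤ, v ≠ 0 → ∀ᵐ x ∂μ, f (v +ᵥ x) ≠ f x)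
    {a N : ℕ} {ε : ℝ} (hε : 0 < ε) (hN : 0 < N) (haN : 4 * d * a ≤ ε * N) (ha : a ≤ N) :
    ∃ B : Set X, MeasurableSet B ∧ IsSeparated (fun _ : Fin d => N + a) B ∧
      1 - ε ≤ ((N - a : ℕ) : ℝ) ^ d * μ.real B := by
  obtain ⟨B, hB, hsep, hlarge⟩ := exists_tower_cube hT hf hfree (r := N + a) (by omega)
    (half_pos hε)
  refine ⟨B, hB, hsep, ?_⟩
  have hNa : (0 : ℝ) < (N + a : ℕ) := by positivity
  have hN' : (0 : ℝ) < N := by positivity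
  have h1 : ((N - a : ℕ) : ℝ) = (1 + -(2 * a / (N + a : ℕ))) * (N + a : ℕ) := by
    rw [Nat.cast_sub ha]
    field_simp
    push_cast
    ring
  have h2 : (2 * a : ℝ) / (N + a : ℕ) ≤ 2 := by
    rw [div_le_iff₀ hNa]
    push_cast
    linarith
  -- By Bernoulli's inequality the volume ratio of the cubes of sides `N - a` and `N + a` is at
  -- least `1 - ε / 2`; the tower of side `N + a` loses another `ε / 2`.
  have h3 := one_add_mul_le_pow (a := -((2 * a : ℝ) / (N + a : ℕ))) (by linarith) d
  have h4 : (d : ℝ) * (2 * a / (N + a : ℕ)) ≤ ε / 2 := by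
    rw [← mul_div_assoc, div_le_iff₀ hNa]
    push_cast
    have : (0 : ℝ) ≤ ε * a := by positivity
    nlinarith
  rw [h1, mul_pow, mul_assoc]
  have h5 : ((N + a : ℕ) : ℝ) ^ d * μ.real B ≤ 1 := by
    have := measureReal_tower hT hB hsep
    simp only [Finset.prod_const, Finset.card_univ, Fintype.card_fin] at this
    rw [← this]
    exact measureReal_le_one
  have h6 : 0 ≤ ((N + a : ℕ) : ℝ) ^ d * μ.real B := by positivity
  have h7 : 1 - ε / 2 ≤ (1 + -((2 * a : ℝ) / (N + a : ℕ))) ^ d := by linarith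
  nlinarith

end Rohlin

/-! ### Splitting sets in prescribed proportions -/

section Split

variable {X : Type*} [MeasurableSpace X] {μ : Measure X} [IsFiniteMeasure μ]

/-- The distribution function of `f` on `B` is continuous since `f` has no atoms, and the
intermediate value theorem gives a sublevel set of the right measure. -/
lemma exists_subset_measureReal_eq {f : X → ℝ} (hf : Measurable f)
    (hatom : ∀ t, μ (f ⁻¹' {t}) = 0) {B : Set X} (hB : MeasurableSet B) {a : ℝ} (ha : 0 ≤ a)
    (haB : a ≤ μ.real B) : ∃ C ⊆ B, MeasurableSet C ∧ μ.real C = a := by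
  rcases ha.eq_or_lt with rfl | ha
  · exact ⟨∅, Set.empty_subset _, MeasurableSet.empty, by simp⟩
  rcases haB.eq_or_lt with rfl | haB
  · exact ⟨B, le_rfl, hB, rfl⟩
  let ν : Measure ℝ := (μ.restrict B).map f
  have hν : ∀ s, MeasurableSet s → ν.real s = μ.real (B ∩ f ⁻¹' s) := by
    intro s hs
    rw [Measure.real, Measure.map_apply hf hs, Measure.restrict_apply (hf hs), Set.inter_comm]
    rfl
  have : IsFiniteMeasure ν := Measure.isFiniteMeasure_map _ _
  have : NullSingletonClass ν := ⟨fun t => by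
    rw [Measure.map_apply hf (measurableSet_singleton t)]
    exact Measure.absolutelyContinuous_of_le Measure.restrict_le_self (hatom t)⟩
  have hcont : Continuous fun t => ν.real (Set.Iic t) := by
    have h1 : Integrable (fun _ : ℝ => (1 : ℝ)) ν := integrable_const 1
    have h2 : Continuous fun t => ν.real (Set.Iic 0) + ∫ _ in (0 : ℝ)..t, (1 : ℝ) ∂ν :=
      continuous_const.add (intervalIntegral.continuous_primitive
        (fun a b => h1.intervalIntegrable) 0)
    convert h2 using 2 with t
    rw [← intervalIntegral.integral_Iic_sub_Iic h1.integrableOn h1.integrableOn]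
    simp
  have hbot : Filter.Tendsto (fun t => ν.real (Set.Iic t)) Filter.atBot (nhds 0) := by
    have h := (ENNReal.tendsto_toReal (measure_ne_top ν _)).comp (tendsto_measure_Ici_atBot ν)
    have h' := h.const_sub (ν.real Set.univ)
    rw [show (ν Set.univ).toReal = ν.real Set.univ from rfl, sub_self] at h'
    refine h'.congr fun t => ?_
    rw [measureReal_congr Iio_ae_eq_Iic.symm, ← Set.compl_Ici, measureReal_compl measurableSet_Ici]
    rfl
  have htop : Filter.Tendsto (fun t => ν.real (Set.Iic t)) Filter.atTop (nhds (μ.real B)) := by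
    have h := (ENNReal.tendsto_toReal (measure_ne_top ν _)).comp (tendsto_measure_Iic_atTop ν)
    have e : (ν Set.univ).toReal = μ.real B := by
      have h' := hν Set.univ MeasurableSet.univ
      rwa [Set.preimage_univ, Set.inter_univ] at h'
    rwa [e] at h
  obtain ⟨t, ht⟩ := mem_range_of_exists_le_of_exists_ge hcont
    ((hbot.eventually (gt_mem_nhds ha)).exists.imp fun _ h => h.le)
    ((htop.eventually (lt_mem_nhds haB)).exists.imp fun _ h => h.le)
  exact ⟨B ∩ f ⁻¹' Set.Iic t, Set.inter_subset_left, hB.inter (hf measurableSet_Iic), by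
    rw [← hν _ measurableSet_Iic, ← ht]⟩

lemma exists_disjoint_measureReal_eq {ι : Type*} {f : X → ℝ} (hf : Measurable f)
    (hatom : ∀ t, μ (f ⁻¹' {t}) = 0) {e : ι → ℝ} (he : ∀ j, 0 ≤ e j) (s : Finset ι) :
    ∀ {B : Set X}, MeasurableSet B → ∑ j ∈ s, e j ≤ μ.real B →
      ∃ E : ι → Set X, (∀ j, MeasurableSet (E j)) ∧ (∀ j, E j ⊆ B) ∧
        (∀ j ∈ s, μ.real (E j) = e j) ∧ (∀ j ∉ s, E j = ∅) ∧
        ∀ j k x, x ∈ E j → x ∈ E k → j = k := by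
  classical
  induction s using Finset.induction_on with
  | empty =>
    intro B _ _
    exact ⟨fun _ => ∅, by simp, by simp, by simp, by simp, by simp⟩
  | insert i s his ih =>
    intro B hB hle
    rw [Finset.sum_insert his] at hle
    have hs : 0 ≤ ∑ j ∈ s, e j := Finset.sum_nonneg fun j _ => he j
    obtain ⟨C, hCB, hC, hCe⟩ := exists_subset_measureReal_eq hf hatom hB (he i) (by linarith)
    obtain ⟨E, hE, hEB, hEe, hE0, hEd⟩ := ih (hB.diff hC) (by
      rw [measureReal_sdiff hCB hC]; linarith)
    have key : ∀ {j x}, x ∈ Function.update E i C j → (j = i ∧ x ∈ C) ∨ (x ∈ E j ∧ x ∉ C) := by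
      intro j x hx
      by_cases hj : j = i
      · subst hj; exact Or.inl ⟨rfl, by simpa using hx⟩
      · rw [Function.update_of_ne hj] at hx
        exact Or.inr ⟨hx, (hEB j hx).2⟩
    refine ⟨Function.update E i C, fun j => ?_, fun j x hx => ?_, fun j hj => ?_, fun j hj => ?_,
      fun j k x hj hk => ?_⟩
    · by_cases hj : j = i
      · subst hj; simpa using hC
      · simpa [hj] using hE j
    · rcases key hx with ⟨-, h⟩ | ⟨h, -⟩
      exacts [hCB h, (hEB j h).1]
    · by_cases hji : j = i
      · subst hji; simpa using hCe
      · rw [Function.update_of_ne hji]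
        exact hEe j ((Finset.mem_insert.1 hj).resolve_left hji)
    · rw [Finset.mem_insert, not_or] at hj
      rw [Function.update_of_ne hj.1, hE0 j hj.2]
    · rcases key hj with ⟨rfl, h⟩ | ⟨h, h'⟩ <;> rcases key hk with ⟨rfl, h''⟩ | ⟨h'', h'''⟩
      · rfl
      · exact (h''' h).elim
      · exact (h' h'').elim
      · exact hEd j k x h h''

end Split

/-! ### Passing from one scale of cubes to the next -/

section Step

variable {d : ℕ} {X : Type*} [MeasurableSpace X] {μ : Measure X} [AddAction (Fin d → ℤ) X]

/-- By Poincaré recurrence for the vector `(1, …, 1)`, a level set of positive measure would contain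
a point returning to it, although `f` separates almost every point from its translates. -/
lemma measure_preimage_singleton_eq_zero [IsFiniteMeasure μ] (hd : 1 ≤ d)
    (hT : ∀ v : Fin d → ℤ, MeasurePreserving (fun x : X => v +ᵥ x) μ μ)
    {f : X → ℝ} (hf : Measurable f) (hfree : ∀ v : Fin d → ℤ, v ≠ 0 → ∀ᵐ x ∂μ, f (v +ᵥ x) ≠ f x)
    (t : ℝ) : μ (f ⁻¹' {t}) = 0 := by
  by_contra h0
  let e : Fin d → ℤ := fun _ => 1
  have hall : ∀ᵐ x ∂μ, ∀ m : ℕ, m ≠ 0 → f ((m • e) +ᵥ x) ≠ f x := by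
    refine ae_all_iff.2 fun m => ?_
    by_cases hm : m = 0
    · simp [hm]
    · refine (hfree (m • e) fun h => hm ?_).mono fun x hx _ => hx
      have := congrFun h ⟨0, hd⟩
      simpa [e] using this
  have hs : (f ⁻¹' {t} ∩ {x | ∀ m : ℕ, m ≠ 0 → f ((m • e) +ᵥ x) ≠ f x} : Set X) =ᵐ[μ]
      f ⁻¹' {t} := Filter.EventuallyEq.of_eq rfl |>.trans (inter_ae_eq_left_of_ae_eq_univ
        (Filter.eventuallyEq_univ.2 hall))
  obtain ⟨x, hx, m, hm, hmx⟩ := (hT e).exists_mem_iterate_mem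
    ((hf (measurableSet_singleton t)).nullMeasurableSet.congr hs.symm) (by rwa [measure_congr hs])
  have hit : ∀ m : ℕ, (fun x : X => e +ᵥ x)^[m] x = (m • e) +ᵥ x := by
    intro m
    induction m with
    | zero => simp
    | succ m ih => rw [Function.iterate_succ_apply', ih, succ_nsmul', add_vadd]
  rw [hit] at hmx
  have h1 : f ((m • e) +ᵥ x) = t := hmx.1
  have h2 : f x = t := hx.1
  exact hx.2 m hm (h1.trans h2.symm)

/-- A finite pattern in a countable set takes countably many values, so anything decided by the
pattern alone is measurable. -/
lemma measurableSet_finset_pattern {G : Type*} [Countable G] {P : X → Finset G}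
    (hP : ∀ u, MeasurableSet {x | u ∈ P x}) (p : Finset G → Prop) :
    MeasurableSet {x | p (P x)} := by
  have h1 : ∀ Q, MeasurableSet {x | P x = Q} := by
    intro Q
    have : {x | P x = Q} = ⋂ u, {x | u ∈ P x ↔ u ∈ Q} := by
      ext x
      simp [Finset.ext_iff]
    rw [this]
    refine MeasurableSet.iInter fun u => ?_
    by_cases hu : u ∈ Q
    · simp only [hu, iff_true]
      exact hP u
    · simp only [hu, iff_false]
      exact (hP u).compl
  have : {x | p (P x)} = ⋃ Q ∈ {Q | p Q}, {x | P x = Q} := by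
    ext x
    simp
  rw [this]
  exact MeasurableSet.biUnion (Set.to_countable _) fun Q _ => h1 Q

lemma IsTiling.sumElim {Y J K : Type*} [AddAction (Fin d → ℤ) Y] {w : J → Fin d → ℕ}
    {w' : K → Fin d → ℕ} {t : J → Set Y} {A : Set Y} (h : IsTiling w t A) :
    IsTiling (Sum.elim w w') (Sum.elim t fun _ => ∅) A := by
  refine isTiling_of_mem_iff ?_ fun x => ?_
  · rintro (j | k) x hx (j' | k') y hy u hu v hv e
    · obtain ⟨rfl, h2⟩ := h.packing j x hx j' y hy u hu v hv e
      exact ⟨rfl, h2⟩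
    · exact hy.elim
    · exact hx.elim
    · exact hx.elim
  · rw [h.mem_iff]
    constructor
    · rintro ⟨j, h⟩
      exact ⟨Sum.inl j, h⟩
    · rintro ⟨j | k, u, hu, y, hy, e⟩
      · exact ⟨j, u, hu, y, hy, e⟩
      · exact hy.elim

/-- The tiles based at the points of `F s` tile the tower of cubes of side `N` over `B`, and each
of them lies in one of the cubes. -/
structure IsCubeTiling {Y S : Type*} [AddAction (Fin d → ℤ) Y] (sh : S → Fin d → ℕ)
    (F : S → Set Y) (N : ℕ) (B : Set Y) : Prop where
  tiling : IsTiling sh F (tower (fun _ : Fin d => N) B)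
  within : ∀ s, ∀ y ∈ F s, ∃ x ∈ B, ∃ v : Fin d → ℤ, v +ᵥ x = y ∧
    ∀ u ∈ latticeRectangle (sh s), u + v ∈ latticeRectangle fun _ : Fin d => N

/-- The points of the tower of cubes of side `N` over `B` at depth at least `a` in their cube. -/
def innerTower {d : ℕ} {Y : Type*} [AddAction (Fin d → ℤ) Y] (w : Fin d → ℕ) (a : ℕ) (B : Set Y) :
    Set Y :=
  (fun y : Y => (fun _ : Fin d => (a : ℤ)) +ᵥ y) '' tower (fun i => w i - 2 * a) B

/-- Extension of a tiling by cubes to larger cubes. The cubes based at `R` are not subdivided. -/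
lemma IsCubeTiling.exists_extension {J : Type*} {w : J → Fin d → ℕ} {N : ℕ → ℕ}
    (hT : ∀ v : Fin d → ℤ, MeasurePreserving (fun x : X => v +ᵥ x) μ μ)
    {n c m : ℕ}
    (hgap : ∀ P : Finset (Fin d → ℤ), (∀ u ∈ P, ∀ i, c ≤ u i ∧ u i + n + c ≤ N m) →
      (∀ u ∈ P, ∀ v ∈ P, (∀ i, |u i - v i| < n + 2 * c) → u = v) →
      ∃ t, IsTiling w t (latticeRectangle (fun _ : Fin d => N m) \
        ⋃ u ∈ P, latticeBox u fun _ => n))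
    {B B' R : Set X} (hBm : MeasurableSet B) (hB'm : MeasurableSet B') (hRm : MeasurableSet R)
    (hB : IsSeparated (fun _ : Fin d => n + 2 * c) B) (hB' : IsSeparated (fun _ : Fin d => N m) B')
    (hR : R ⊆ B') {F : J ⊕ ℕ → Set X} (hF : ∀ s, MeasurableSet (F s))
    (h : IsCubeTiling (Sum.elim w fun k _ => N k) F n B) :
    ∃ F' : J ⊕ ℕ → Set X, (∀ s, MeasurableSet (F' s)) ∧
      IsCubeTiling (Sum.elim w fun k _ => N k) F' (N m) B' ∧ R ⊆ F' (Sum.inr m) ∧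
      ∀ s, ∀ y ∈ F s, ∀ u ∈ latticeRectangle ((Sum.elim w fun k _ => N k : _ → Fin d → ℕ) s),
        u +ᵥ y ∈ innerTower (fun _ : Fin d => N m) (c + n) (B' \ R) → y ∈ F' s := by
  classical
  set sh : J ⊕ ℕ → Fin d → ℕ := Sum.elim w fun k _ => N k with hsh
  have hn : IsSeparated (fun _ : Fin d => n) B := hB.anti (fun _ => by omega) le_rfl
  -- The gap tiling is chosen once per pattern `P` and not per point; this is what makes the new
  -- tiles measurable.
  choose! T hTil using hgap
  let U : Finset (Fin d → ℤ) := Fintype.piFinset fun _ => Finset.Icc (c : ℤ) (N m - n - c)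
  have hU : ∀ u, u ∈ U ↔ ∀ i, c ≤ u i ∧ u i + n + c ≤ N m := by
    intro u
    simp only [U, Fintype.mem_piFinset, Finset.mem_Icc]
    exact forall_congr' fun i => by omega
  let P : X → Finset (Fin d → ℤ) := fun x => U.filter fun u => u +ᵥ x ∈ B
  have hPm : ∀ u, MeasurableSet {x | u ∈ P x} := by
    intro u
    by_cases hu : u ∈ U
    · simp only [P, Finset.mem_filter, hu, true_and]
      exact (hT u).measurable hBm
    · simp [P, hu]
  have hTP : ∀ x, IsTiling w (T (P x)) (latticeRectangle (fun _ : Fin d => N m) \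
      ⋃ u ∈ P x, latticeBox u fun _ => n) := by
    intro x
    refine hTil _ (fun u hu => (hU u).1 (Finset.mem_filter.1 hu).1) fun u hu v hv huv => ?_
    have h1 := (Finset.mem_filter.1 hu).2
    have h2 := (Finset.mem_filter.1 hv).2
    have h3 : (u - v) +ᵥ v +ᵥ x = u +ᵥ x := by rw [← add_vadd, sub_add_cancel]
    exact sub_eq_zero.1 (isSeparated_const_iff.1 hB _ h2 (u - v)
      (fun i => by exact_mod_cast huv i) (h3 ▸ h1))
  -- Bases of the old cubes that are kept: those at depth at least `c` in an unreserved new cube.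
  let Br : Set X := {z | z ∈ B ∧ ∃ x ∈ B' \ R, ∃ u ∈ U, u +ᵥ x = z}
  have hBrB : Br ⊆ B := fun z hz => hz.1
  have hBr : MeasurableSet Br := by
    refine hBm.inter ?_
    have := measurableSet_biUnion_vadd (B := B' \ R) (t := fun _ => (U : Set (Fin d → ℤ))) hT
      fun v => by
        by_cases hv : v ∈ (U : Set (Fin d → ℤ))
        · simp only [hv, and_true]
          exact hB'm.diff hRm
        · simp only [hv, and_false]
          exact MeasurableSet.empty
    exact this
  let F₁ : J ⊕ ℕ → Set X := fun s => {y | y ∈ F s ∧ ∃ z ∈ Br, ∃ v ∈ {v : Fin d → ℤ |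
    ∀ u ∈ latticeRectangle (sh s), u + v ∈ latticeRectangle fun _ : Fin d => n}, v +ᵥ z = y}
  have hF₁ : ∀ s, MeasurableSet (F₁ s) := fun s => (hF s).inter
    (measurableSet_biUnion_vadd hT fun v => by
      by_cases hv : v ∈ {v : Fin d → ℤ |
          ∀ u ∈ latticeRectangle (sh s), u + v ∈ latticeRectangle fun _ : Fin d => n}
      · simp only [hv, and_true]; exact hBr
      · simp only [hv, and_false]; exact MeasurableSet.empty)
  -- Every old tile lies within one old cube, so keeping or discarding whole cubes never cuts a
  -- tile.
  have ht₁ : IsTiling sh F₁ (tower (fun _ : Fin d => n) Br) := by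
    refine isTiling_of_mem_iff (h.tiling.packing.anti fun s y hy => hy.1) fun x => ?_
    rw [mem_tower]
    constructor
    · rintro ⟨a, ha, z, hz, rfl⟩
      obtain ⟨s, u, hu, y, hy, e⟩ := h.tiling.mem_iff.1 (mem_tower.2 ⟨a, ha, z, hz.1, rfl⟩)
      obtain ⟨x, hx, v, rfl, hv⟩ := h.within s y hy
      rw [← add_vadd] at e
      obtain rfl := hn x hx z hz.1 _ (hv u hu) a ha e
      obtain rfl := vadd_left_cancel _ e
      exact ⟨s, u, hu, _, ⟨hy, x, hz, v, hv, rfl⟩, by rw [add_vadd]⟩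
    · rintro ⟨s, u, hu, y, ⟨hy, z, hz, v, hv, rfl⟩, rfl⟩
      exact ⟨u + v, hv u hu, z, hz, by rw [add_vadd]⟩
  have hB'R : IsSeparated (fun _ : Fin d => N m) (B' \ R) := hB'.anti (fun _ => le_rfl)
    Set.sdiff_subset
  have ht₂ := isTiling_biUnion_vadd hB'R (sh := sh)
    (t := fun x => Sum.elim (T (P x)) fun _ => ∅)
    (fun x _ => (hTP x).sumElim) (fun x _ => Set.sdiff_subset)
  have ht₃ := isTiling_tower (sh := sh) (s := Sum.inr m) (hB'.anti (fun _ => le_rfl) hR)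
  have hBrB' : ∀ a ∈ latticeRectangle (fun _ : Fin d => n), ∀ u ∈ U,
      a + u ∈ latticeRectangle (fun _ : Fin d => N m) := by
    intro a ha u hu i
    have h1 := ha i
    have h2 := (hU u).1 hu i
    simp only [Pi.add_apply] at h1 ⊢
    omega
  have key : ∀ x ∈ B' \ R, ∀ v ∈ latticeRectangle (fun _ : Fin d => N m),
      (v +ᵥ x ∈ tower (fun _ : Fin d => n) Br ↔ v ∈ ⋃ u ∈ P x, latticeBox u fun _ => n) := by
    intro x hx v hv
    simp only [Set.mem_iUnion, mem_tower, exists_prop]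
    constructor
    · rintro ⟨a, ha, _, ⟨hz, x', hx', u, hu, rfl⟩, e⟩
      rw [← add_vadd] at e
      obtain rfl := hB' x' hx'.1 x hx.1 _ (hBrB' a ha u hu) v hv e
      obtain rfl := vadd_left_cancel _ e
      refine ⟨u, Finset.mem_filter.2 ⟨hu, hz⟩, fun i => ?_⟩
      have h1 := ha i
      simp only [Pi.add_apply] at h1 ⊢
      omega
    · rintro ⟨u, hu, hvu⟩
      have hu' := Finset.mem_filter.1 hu
      refine ⟨v - u, fun i => ?_, u +ᵥ x, ⟨hu'.2, x, hx, u, hu'.1, rfl⟩, by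
        rw [← add_vadd, sub_add_cancel]⟩
      have h1 := hvu i
      simp only [Pi.sub_apply] at h1 ⊢
      omega
  have hd₁ : Disjoint (tower (fun _ : Fin d => n) Br) {y | ∃ x ∈ B' \ R,
      ∃ v ∈ latticeRectangle (fun _ : Fin d => N m) \ ⋃ u ∈ P x, latticeBox u fun _ => n,
        v +ᵥ x = y} := by
    refine Set.disjoint_left.2 ?_
    rintro _ hy ⟨x, hx, v, hv, rfl⟩
    exact hv.2 ((key x hx v hv.1).1 hy)
  have hd₂ : Disjoint (tower (fun _ : Fin d => n) Br ∪ {y | ∃ x ∈ B' \ R,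
      ∃ v ∈ latticeRectangle (fun _ : Fin d => N m) \ ⋃ u ∈ P x, latticeBox u fun _ => n,
        v +ᵥ x = y}) (tower (sh (Sum.inr m)) R) := by
    have h1 : ∀ x ∈ B' \ R, ∀ v ∈ latticeRectangle (fun _ : Fin d => N m),
        v +ᵥ x ∉ tower (sh (Sum.inr m)) R := by
      intro x hx v hv hvx
      obtain ⟨u, hu, y, hy, e⟩ := mem_tower.1 hvx
      obtain rfl := hB' y (hR hy) x hx.1 u hu v hv e
      exact hx.2 (vadd_left_cancel _ e ▸ hy)
    refine Set.disjoint_left.2 ?_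
    rintro y (hy | ⟨x, hx, v, hv, rfl⟩) hy'
    · obtain ⟨a, ha, _, ⟨hz, x, hx, u, hu, rfl⟩, rfl⟩ := mem_tower.1 hy
      rw [← add_vadd] at hy'
      exact h1 x hx _ (hBrB' a ha u hu) hy'
    · exact h1 x hx v hv.1 hy'
  have ht := (ht₁.union ht₂ hd₁).union ht₃ hd₂
  refine ⟨_, fun s => ?_, ⟨ht.of_eq ?_, ?_⟩, ?_, ?_⟩
  · refine ((hF₁ s).union (measurableSet_biUnion_vadd hT fun v => ?_)).union ?_
    · exact (hB'm.diff hRm).inter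
        (measurableSet_finset_pattern hPm fun Q => v ∈ Sum.elim (T Q) (fun _ => ∅) s)
    · split_ifs
      exacts [hRm, MeasurableSet.empty]
  · ext y
    rw [mem_tower]
    constructor
    · rintro ⟨v, hv, x, hx, rfl⟩
      by_cases hxR : x ∈ R
      · exact Or.inr (mem_tower.2 ⟨v, hv, x, hxR, rfl⟩)
      · by_cases hvx : v +ᵥ x ∈ tower (fun _ : Fin d => n) Br
        · exact Or.inl (Or.inl hvx)
        · exact Or.inl (Or.inr ⟨x, ⟨hx, hxR⟩, v,
            ⟨hv, fun hv' => hvx ((key x ⟨hx, hxR⟩ v hv).2 hv')⟩, rfl⟩)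
    · rintro ((hy | ⟨x, hx, v, hv, rfl⟩) | hy)
      · obtain ⟨a, ha, _, ⟨hz, x, hx, u, hu, rfl⟩, rfl⟩ := mem_tower.1 hy
        exact ⟨a + u, hBrB' a ha u hu, x, hx.1, by rw [add_vadd]⟩
      · exact ⟨v, hv.1, x, hx.1, rfl⟩
      · obtain ⟨u, hu, x, hx, rfl⟩ := mem_tower.1 hy
        exact ⟨u, hu, x, hR hx, rfl⟩
  · rintro s y ((⟨hy, _, ⟨hz, x, hx, u, hu, rfl⟩, v, hv, rfl⟩ | ⟨x, hx, v, hv, rfl⟩) | hy)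
    · exact ⟨x, hx.1, v + u, by rw [add_vadd], fun a ha => by
        rw [← add_assoc]; exact hBrB' _ (hv a ha) u hu⟩
    · exact ⟨x, hx.1, v, rfl, fun a ha =>
        ((hTP x).sumElim.mem_iff (x := a + v)|>.2 ⟨s, a, ha, v, hv, rfl⟩).1⟩
    · split_ifs at hy with hs
      · subst hs
        exact ⟨y, hR hy, 0, zero_vadd _ _, fun a ha => by rw [add_zero]; exact ha⟩
      · exact hy.elim
  · intro x hx
    exact Or.inr (by simpa using hx)
  · intro s y hy u hu huy
    obtain ⟨x₀, hx₀, v₀, rfl, hv₀⟩ := h.within s y hy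
    obtain ⟨_, hy', e⟩ := huy
    obtain ⟨b, hb, x, hx, rfl⟩ := mem_tower.1 hy'
    -- The witness is the position of the old cube in the new one. The tile's point has depth at
    -- least `c + n` in the new cube, and an old cube has side `n`, so the old cube has depth at
    -- least `c` and was kept.
    refine Or.inl (Or.inl ⟨hy, x₀, ⟨hx₀, x, hx, (fun _ => ((c + n : ℕ) : ℤ)) + b - (u + v₀),
      (hU _).2 fun i => ?_, ?_⟩, v₀, hv₀, rfl⟩)
    · have h1 := hb i
      have h2 := hv₀ u hu i
      simp only [Pi.add_apply, Pi.sub_apply] at h1 h2 ⊢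
      omega
    · simp only [← add_vadd] at e
      rw [sub_eq_neg_add, add_vadd, e, neg_vadd_vadd]

end Step

/-! ### The limit of the cube tilings -/

section Limit

variable {d : ℕ} {X : Type*} [MeasurableSpace X] {μ : Measure X} [AddAction (Fin d → ℤ) X]

lemma exists_seq_of_step {α : Type*} (Q : ℕ → α → Prop) (R : ℕ → α → α → Prop)
    (h0 : ∃ a, Q 0 a) (hstep : ∀ n a, Q n a → ∃ b, Q (n + 1) b ∧ R n a b) :
    ∃ u : ℕ → α, (∀ n, Q n (u n)) ∧ ∀ n, R n (u n) (u (n + 1)) := by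
  obtain ⟨a₀, ha₀⟩ := h0
  choose g hg using hstep
  let v : ∀ n, {a // Q n a} := fun n =>
    Nat.rec ⟨a₀, ha₀⟩ (fun n a => ⟨g n a.1 a.2, (hg n a.1 a.2).1⟩) n
  exact ⟨fun n => (v n).1, fun n => (v n).2, fun n => (hg n (v n).1 (v n).2).2⟩

/-- The eventual tiles of a sequence of packings, where tiles meeting `D (l + 1)` survive the
passage from the `l`th packing to the next one. -/
lemma exists_limit_packing [IsProbabilityMeasure μ] {S : Type*} {sh : S → Fin d → ℕ}
    {F : ℕ → S → Set X} (hF : ∀ l s, MeasurableSet (F l s)) (hpack : ∀ l, IsPacking sh (F l))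
    {D : ℕ → Set X} (hpersist : ∀ l s, ∀ y ∈ F l s, ∀ u ∈ latticeRectangle (sh s),
      u +ᵥ y ∈ D (l + 1) → y ∈ F (l + 1) s)
    (hD : ∀ l, D (l + 1) ⊆ ⋃ s, tower (sh s) (F (l + 1) s)) {β : ℕ → ℝ} (hβ : Summable β)
    (hβD : ∀ l, μ.real (D (l + 1))ᶜ ≤ β l) :
    ∃ G : S → Set X, (∀ s, MeasurableSet (G s)) ∧ IsPacking sh G ∧
      (∀ᵐ x ∂μ, x ∈ ⋃ s, tower (sh s) (G s)) ∧
      ∀ m s, ∀ R ⊆ F m s, μ.real (tower (sh s) R) - ∑' l, β (l + m) ≤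
        μ.real (tower (sh s) (G s)) := by
  have hstay : ∀ s y, ∀ u ∈ latticeRectangle (sh s), ∀ m, y ∈ F m s →
      (∀ l, u +ᵥ y ∈ D (m + l + 1)) → ∀ l, y ∈ F (m + l) s := by
    intro s y u hu m hy h l
    induction l with
    | zero => exact hy
    | succ l ih => exact hpersist _ s y ih u hu (h l)
  have hGmem : ∀ s y, ∀ u ∈ latticeRectangle (sh s), ∀ m, y ∈ F m s →
      (∀ l, u +ᵥ y ∈ D (m + l + 1)) → ∃ m, ∀ l, m ≤ l → y ∈ F l s := by
    intro s y u hu m hy h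
    refine ⟨m, fun l hl => ?_⟩
    obtain ⟨k, rfl⟩ := Nat.exists_eq_add_of_le hl
    exact hstay s y u hu m hy h k
  -- The limit base is the set-theoretic liminf. Two of its points already lie in a common stage,
  -- whence the packing property.
  refine ⟨fun s => {y | ∃ m, ∀ l, m ≤ l → y ∈ F l s}, fun s => ?_, ?_, ?_, ?_⟩
  · have : {y | ∃ m, ∀ l, m ≤ l → y ∈ F l s} = ⋃ m, ⋂ l, ⋂ (_ : m ≤ l), F l s := by
      ext y
      simp
    beta_reduce
    rw [this]
    exact MeasurableSet.iUnion fun m => MeasurableSet.iInter fun l =>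
      MeasurableSet.iInter fun _ => hF l s
  · rintro s x ⟨m, hm⟩ s' y ⟨m', hm'⟩
    exact hpack (max m m') s x (hm _ (le_max_left _ _)) s' y (hm' _ (le_max_right _ _))
  · have hfin : ∑' l, μ (D (l + 1))ᶜ ≠ ⊤ := by
      refine ne_top_of_le_ne_top hβ.tsum_ofReal_ne_top (ENNReal.tsum_le_tsum fun l => ?_)
      rw [← ofReal_measureReal]
      exact ENNReal.ofReal_le_ofReal (hβD l)
    -- By Borel–Cantelli almost every point lies in all `D (l + 1)` from some stage on, and then its
    -- tile never changes again.
    filter_upwards [ae_eventually_notMem hfin] with x hx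
    obtain ⟨m, hm⟩ := Filter.eventually_atTop.1 hx
    have hxD : ∀ l, m ≤ l → x ∈ D (l + 1) := fun l hl => not_not.1 (hm l hl)
    obtain ⟨s, hs⟩ := Set.mem_iUnion.1 (hD m (hxD m le_rfl))
    obtain ⟨u, hu, y, hy, rfl⟩ := mem_tower.1 hs
    exact Set.mem_iUnion.2 ⟨s, mem_tower.2 ⟨u, hu, y,
      hGmem s y u hu (m + 1) hy fun l => hxD _ (by omega), rfl⟩⟩
  · intro m s R hR
    have hsub : tower (sh s) R ⊆ tower (sh s) {y | ∃ m, ∀ l, m ≤ l → y ∈ F l s} ∪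
        ⋃ l, (D (l + m + 1))ᶜ := by
      intro x hx
      by_cases h : ∀ l, x ∈ D (m + l + 1)
      · obtain ⟨u, hu, y, hy, rfl⟩ := mem_tower.1 hx
        exact Or.inl (mem_tower.2 ⟨u, hu, y, hGmem s y u hu m (hR hy) h, rfl⟩)
      · push Not at h
        obtain ⟨l, hl⟩ := h
        exact Or.inr (Set.mem_iUnion.2 ⟨l, by rwa [add_comm l m]⟩)
    have hβm : Summable fun l => β (l + m) := (summable_nat_add_iff m).2 hβ
    have hβ0 : ∀ l, 0 ≤ β l := fun l => measureReal_nonneg.trans (hβD l)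
    have hU : μ.real (⋃ l, (D (l + m + 1))ᶜ) ≤ ∑' l, β (l + m) := by
      refine ENNReal.toReal_le_of_le_ofReal (tsum_nonneg fun l => hβ0 _) ?_
      refine (measure_iUnion_le _).trans ?_
      rw [ENNReal.ofReal_tsum_of_nonneg (fun l => hβ0 _) hβm]
      refine ENNReal.tsum_le_tsum fun l => ?_
      rw [← ofReal_measureReal]
      exact ENNReal.ofReal_le_ofReal (hβD _)
    have := (measureReal_mono hsub (measure_ne_top μ _)).trans (measureReal_union_le _ _)
    linarith

/-- A packing by tiles of the shapes `w j` and by cubes of the sides `N m` that covers almost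
every point, with lower bounds for the measures covered by the cubes. -/
lemma exists_packing_cubes [IsProbabilityMeasure μ] (hd : 1 ≤ d) {J : Type*} {w : J → Fin d → ℕ}
    (hT : ∀ v : Fin d → ℤ, MeasurePreserving (fun x : X => v +ᵥ x) μ μ)
    {f : X → ℝ} (hf : Measurable f) (hfree : ∀ v : Fin d → ℤ, v ≠ 0 → ∀ᵐ x ∂μ, f (v +ᵥ x) ≠ f x)
    {N : ℕ → ℕ} {c : ℕ} (hN0 : ∀ l, 0 < N l)
    (hgap : ∀ l, ∀ P : Set (Fin d → ℤ), (∀ u ∈ P, ∀ i, c ≤ u i ∧ u i + N l + c ≤ N (l + 1)) →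
      (∀ u ∈ P, ∀ v ∈ P, (∀ i, |u i - v i| < N l + 2 * c) → u = v) →
      ∃ t, IsTiling w t (latticeRectangle (fun _ : Fin d => N (l + 1)) \
        ⋃ u ∈ P, latticeBox u fun _ => N l))
    {ε ρ : ℕ → ℝ} (hε : ∀ l, 0 < ε l) (hρ : ∀ l, 0 ≤ ρ l) (hερ : ∀ l, ε l + ρ l ≤ 1)
    (hNε₀ : 8 * d * c ≤ ε 0 * N 0) (hcN₀ : 2 * c ≤ N 0)
    (hNε : ∀ l, 8 * d * (c + N l : ℕ) ≤ ε (l + 1) * N (l + 1))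
    (hcN : ∀ l, 2 * (c + N l) ≤ N (l + 1))
    (hβ : Summable fun l => ε (l + 1) + ρ (l + 1)) :
    ∃ G : J ⊕ ℕ → Set X, (∀ s, MeasurableSet (G s)) ∧
      IsPacking (Sum.elim w fun k _ => N k) G ∧
      (∀ᵐ x ∂μ, x ∈ ⋃ s, tower ((Sum.elim w fun k _ => N k : _ → Fin d → ℕ) s) (G s)) ∧
      ∀ m, ρ m - ∑' l, (ε (l + m + 1) + ρ (l + m + 1)) ≤
        μ.real (tower (fun _ : Fin d => N m) (G (Sum.inr m))) := by
  classical
  set sh : J ⊕ ℕ → Fin d → ℕ := Sum.elim w fun k _ => N k with hsh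
  have hatom := measure_preimage_singleton_eq_zero hd hT hf hfree
  have hdata : ∀ l, ∃ B R : Set X, MeasurableSet B ∧ MeasurableSet R ∧ R ⊆ B ∧
      IsSeparated (fun _ : Fin d => N l + 2 * c) B ∧ (N l : ℝ) ^ d * μ.real R = ρ l ∧
      ∀ k, l = k + 1 →
        1 - ε l ≤ ((N l - 2 * (c + N k) : ℕ) : ℝ) ^ d * μ.real B := by
    -- The slack `a` pays twice: separation by `N l + a` leaves room around the cubes for the next
    -- stage, and the core of side `N l - a` is still nearly everything. The condition `ε l + ρ l ≤
    -- 1` leaves enough base for the reserved cubes.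
    have key : ∀ l a, 2 * c ≤ a → (4 * d * a : ℝ) ≤ ε l * N l → a ≤ N l →
        ∃ B R : Set X, MeasurableSet B ∧ MeasurableSet R ∧ R ⊆ B ∧
          IsSeparated (fun _ : Fin d => N l + 2 * c) B ∧ (N l : ℝ) ^ d * μ.real R = ρ l ∧
          1 - ε l ≤ ((N l - a : ℕ) : ℝ) ^ d * μ.real B := by
      intro l a hca ha haN
      obtain ⟨B, hB, hsep, hBl⟩ := exists_isSeparated_add hT hf hfree (hε l) (hN0 l) ha haN
      have hNl : (0 : ℝ) < (N l : ℝ) ^ d := by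
        have := hN0 l
        positivity
      have h1 : ((N l - a : ℕ) : ℝ) ^ d * μ.real B ≤ (N l : ℝ) ^ d * μ.real B := by
        gcongr
        omega
      have h2 : ρ l / (N l : ℝ) ^ d ≤ μ.real B := by
        rw [div_le_iff₀ hNl]
        linarith [hερ l]
      obtain ⟨R, hRB, hR, hRe⟩ := exists_subset_measureReal_eq hf hatom hB
        (div_nonneg (hρ l) hNl.le) h2
      refine ⟨B, R, hB, hR, hRB, hsep.anti (fun _ => by omega) le_rfl, ?_, hBl⟩
      rw [hRe]
      field_simp
    rintro (_ | k)
    · obtain ⟨B, R, hB, hR, hRB, hsep, hRe, -⟩ := key 0 (2 * c) le_rfl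
        (by push_cast; linarith) hcN₀
      exact ⟨B, R, hB, hR, hRB, hsep, hRe, fun k hk => by omega⟩
    · obtain ⟨B, R, hB, hR, hRB, hsep, hRe, hBl⟩ := key (k + 1) (2 * (c + N k)) (by omega)
        (by have := hNε k; push_cast at this ⊢; linarith) (hcN k)
      refine ⟨B, R, hB, hR, hRB, hsep, hRe, fun k' hk' => ?_⟩
      obtain rfl : k' = k := by omega
      exact hBl
  choose B R hB hR hRB hsep hRe hBl using hdata
  have hsepN : ∀ l, IsSeparated (fun _ : Fin d => N l) (B l) := fun l =>
    (hsep l).anti (fun _ => by omega) le_rfl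
  let D : ℕ → Set X := fun l => match l with
    | 0 => ∅
    | l + 1 => innerTower (fun _ : Fin d => N (l + 1)) (c + N l) (B (l + 1) \ R (l + 1))
  obtain ⟨F, hF, hFstep⟩ := exists_seq_of_step
    (fun l (F : J ⊕ ℕ → Set X) => (∀ s, MeasurableSet (F s)) ∧ IsCubeTiling sh F (N l) (B l) ∧
      R l ⊆ F (Sum.inr l))
    (fun l F F' => ∀ s, ∀ y ∈ F s, ∀ u ∈ latticeRectangle (sh s), u +ᵥ y ∈ D (l + 1) → y ∈ F' s)
    (by
      refine ⟨fun s => if s = Sum.inr 0 then B 0 else ∅, fun s => ?_,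
        ⟨isTiling_tower (sh := sh) (s := Sum.inr 0) (hsepN 0), ?_⟩, ?_⟩
      · beta_reduce
        split_ifs
        exacts [hB 0, MeasurableSet.empty]
      · intro s y hy
        split_ifs at hy with hs
        · subst hs
          exact ⟨y, hy, 0, zero_vadd _ _, fun a ha => by rw [add_zero]; exact ha⟩
        · exact hy.elim
      · simpa using hRB 0)
    (by
      rintro l F ⟨hFm, hFt, -⟩
      obtain ⟨F', h1, h2, h3, h4⟩ := hFt.exists_extension (m := l + 1) hT
        (fun P => hgap l P) (hB l) (hB (l + 1)) (hR (l + 1)) (hsep l)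
        (hsepN _) (hRB _) hFm
      exact ⟨F', ⟨h1, h2, h3⟩, h4⟩)
  have hDsub : ∀ l, D (l + 1) ⊆ ⋃ s, tower (sh s) (F (l + 1) s) := by
    rintro l _ ⟨y, hy, rfl⟩
    rw [(hF (l + 1)).2.1.tiling.cover]
    obtain ⟨v, hv, x, hx, rfl⟩ := mem_tower.1 hy
    refine mem_tower.2 ⟨(fun _ => ((c + N l : ℕ) : ℤ)) + v, fun i => ?_, x, hx.1, by
      simp [add_vadd]⟩
    have := hv i
    simp only [Pi.add_apply] at this ⊢
    omega
  have hDm : ∀ l, μ.real (D (l + 1))ᶜ ≤ ε (l + 1) + ρ (l + 1) := by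
    intro l
    have hm : MeasurableSet (B (l + 1) \ R (l + 1)) := (hB _).diff (hR _)
    have hinner := measurableSet_tower hT (fun _ => N (l + 1) - 2 * (c + N l)) hm
    have hDm : MeasurableSet (D (l + 1)) := measurableSet_image_vadd hT _ hinner
    have h1 : μ.real (D (l + 1)) =
        ((N (l + 1) - 2 * (c + N l) : ℕ) : ℝ) ^ d * (μ.real (B (l + 1)) - μ.real (R (l + 1))) := by
      have h2 : μ.real (D (l + 1)) = _ := measureReal_image_vadd hT _ hinner
      rw [h2, measureReal_tower hT hm
        ((hsepN (l + 1)).anti (fun _ => Nat.sub_le _ _) Set.sdiff_subset),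
        measureReal_sdiff (hRB _) (hR _)]
      simp
    have h3 : ((N (l + 1) - 2 * (c + N l) : ℕ) : ℝ) ^ d * μ.real (R (l + 1)) ≤ ρ (l + 1) := by
      rw [← hRe]
      gcongr
      omega
    have h4 := hBl (l + 1) l rfl
    rw [measureReal_compl hDm, probReal_univ, h1]
    linarith
  obtain ⟨G, hGm, hGp, hGc, hGl⟩ := exists_limit_packing (fun l => (hF l).1)
    (fun l => (hF l).2.1.tiling.packing) hFstep hDsub hβ hDm
  refine ⟨G, hGm, hGp, hGc, fun m => ?_⟩
  have := hGl m (Sum.inr m) (R m) (hF m).2.2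
  have h1 := measureReal_tower hT (hR m) ((hsepN m).anti (fun _ => le_rfl) (hRB m))
  simp only [Finset.prod_const, Finset.card_univ, Fintype.card_fin] at h1
  rw [hRe] at h1
  have h2 : tower (sh (Sum.inr m)) (R m) = tower (fun _ => N m) (R m) := rfl
  rw [h2, h1] at this
  exact this

end Limit

/-! ### Cutting cubes to obtain the exact measures -/

section Retile

variable {d : ℕ} {X : Type*} [MeasurableSpace X] {μ : Measure X} [AddAction (Fin d → ℤ) X]

lemma exists_tower_eq_of_dvd
    (hT : ∀ v : Fin d → ℤ, MeasurePreserving (fun x : X => v +ᵥ x) μ μ)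
    {w w' : Fin d → ℕ} (hw : ∀ i, 0 < w i) (h : ∀ i, w i ∣ w' i) {E : Set X}
    (hE : MeasurableSet E) (hs : IsSeparated w' E) :
    ∃ H, MeasurableSet H ∧ IsSeparated w H ∧ tower w H = tower w' E := by
  obtain ⟨t, ht⟩ := exists_isTiling_latticeRectangle_of_dvd hw h
  have h1 := isTiling_biUnion_vadd hs (t := fun _ => t) (fun _ _ => ht) (fun _ _ => le_rfl)
  refine ⟨_, measurableSet_biUnion_vadd hT (t := fun _ => t ()) fun v => ?_,
    h1.packing.isSeparated (), ?_⟩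
  · by_cases hv : v ∈ t ()
    · simp only [hv, and_true]; exact hE
    · simp only [hv, and_false]; exact MeasurableSet.empty
  · have h2 := h1.cover
    have h3 := h2.symm.trans (Set.iUnion_const (ι := Unit)
      (tower w {y | ∃ x ∈ E, ∃ v ∈ t (), v +ᵥ x = y}))
    rw [← h3]
    ext y
    rw [mem_tower]
    constructor
    · rintro ⟨x, hx, v, hv, e⟩
      exact ⟨v, hv, x, hx, e⟩
    · rintro ⟨v, hv, x, hx, e⟩
      exact ⟨x, hx, v, hv, e⟩

/-- Tiles of the shapes `sh s` are cut into tiles of the shapes `w j`, where a set of measure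
`e s j` of the tiles of shape `sh s` is used for the shape `w j`. -/
lemma exists_packing_of_transport [IsProbabilityMeasure μ] (hd : 1 ≤ d) {ι S : Type*}
    [Countable S] {w : ι → Fin d → ℕ} (hw : ∀ j i, 0 < w j i) {sh : S → Fin d → ℕ}
    (hsh : ∀ s i, 0 < sh s i)
    (hT : ∀ v : Fin d → ℤ, MeasurePreserving (fun x : X => v +ᵥ x) μ μ)
    {f : X → ℝ} (hf : Measurable f) (hfree : ∀ v : Fin d → ℤ, v ≠ 0 → ∀ᵐ x ∂μ, f (v +ᵥ x) ≠ f x)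
    {G : S → Set X} (hG : ∀ s, MeasurableSet (G s)) (hpack : IsPacking sh G)
    {e : S → ι → ℝ} (he : ∀ s j, 0 ≤ e s j) {I : S → Finset ι} (hI : ∀ s, ∀ j ∉ I s, e s j = 0)
    (hdvd : ∀ s, ∀ j ∈ I s, ∀ i, w j i ∣ sh s i)
    (hsum : ∀ s, ∑ j ∈ I s, e s j ≤ μ.real (tower (sh s) (G s)))
    {p : ι → ℝ} (hp : ∀ j, HasSum (fun s => e s j) (p j)) :
    ∃ H : ι → Set X, (∀ j, MeasurableSet (H j)) ∧ IsPacking w H ∧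
      ∀ j, μ.real (tower (w j) (H j)) = p j := by
  classical
  have hatom := measure_preimage_singleton_eq_zero hd hT hf hfree
  have hcard : ∀ s, (0 : ℝ) < ∏ i, (sh s i : ℝ) := fun s =>
    Finset.prod_pos fun i _ => by exact_mod_cast hsh s i
  have hE : ∀ s, ∃ E : ι → Set X, (∀ j, MeasurableSet (E j)) ∧ (∀ j, E j ⊆ G s) ∧
      (∀ j, μ.real (tower (sh s) (E j)) = e s j) ∧ (∀ j ∉ I s, E j = ∅) ∧
      ∀ j k x, x ∈ E j → x ∈ E k → j = k := by
    intro s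
    have hsep := hpack.isSeparated s
    obtain ⟨E, h1, h2, h3, h4, h5⟩ := exists_disjoint_measureReal_eq hf hatom
      -- A prescribed tower measure is converted into a measure of the base by dividing by the
      -- number of levels.
      (e := fun j => e s j / ∏ i, (sh s i : ℝ)) (fun j => div_nonneg (he s j) (hcard s).le) (I s)
      (hG s) (by
        rw [← Finset.sum_div, div_le_iff₀ (hcard s), mul_comm, ← measureReal_tower hT (hG s) hsep]
        exact hsum s)
    refine ⟨E, h1, h2, fun j => ?_, h4, h5⟩
    by_cases hj : j ∈ I s
    · rw [measureReal_tower hT (h1 j) (hsep.anti (fun _ => le_rfl) (h2 j)), h3 j hj,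
        mul_div_cancel₀ _ (hcard s).ne']
    · rw [h4 j hj, hI s j hj]
      simp [tower]
  choose E hEm hEG hEe hE0 hEd using hE
  have hsepE : ∀ s j, IsSeparated (sh s) (E s j) := fun s j =>
    (hpack.isSeparated s).anti (fun _ => le_rfl) (hEG s j)
  have hH : ∀ s j, ∃ H, MeasurableSet H ∧ IsSeparated (w j) H ∧
      tower (w j) H = tower (sh s) (E s j) := by
    intro s j
    by_cases hj : j ∈ I s
    · exact exists_tower_eq_of_dvd hT (hw j) (hdvd s j hj) (hEm s j) (hsepE s j)
    · refine ⟨∅, MeasurableSet.empty, fun x hx => hx.elim, ?_⟩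
      rw [hE0 s j hj]
      simp [tower]
  choose H hHm hHs hHt using hH
  have hdisj : ∀ s j s' j' x, x ∈ tower (sh s) (E s j) → x ∈ tower (sh s') (E s' j') →
      s = s' ∧ j = j' := by
    intro s j s' j' x hx hx'
    obtain ⟨u, hu, y, hy, rfl⟩ := mem_tower.1 hx
    obtain ⟨v, hv, z, hz, e'⟩ := mem_tower.1 hx'
    obtain ⟨rfl, rfl⟩ := hpack s' z (hEG _ _ hz) s y (hEG _ _ hy) v hv u hu e'
    obtain rfl := vadd_left_cancel _ e'
    exact ⟨rfl, hEd _ _ _ _ hy hz⟩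
  have htil := isTiling_iUnion (I := S × ι) (sh := w)
    (F := fun a k => if k = a.2 then H a.1 a.2 else ∅) (A := fun a => tower (w a.2) (H a.1 a.2))
    (fun a => isTiling_tower (hHs a.1 a.2)) (by
      rintro ⟨s, j⟩ ⟨s', j'⟩ x hx hx'
      rw [hHt] at hx hx'
      obtain ⟨rfl, rfl⟩ := hdisj _ _ _ _ x hx hx'
      rfl)
  refine ⟨fun j => ⋃ s, H s j, fun j => MeasurableSet.iUnion fun s => hHm s j,
    htil.packing.anti fun j => ?_, fun j => ?_⟩
  · refine Set.iUnion_subset fun s x hx => Set.mem_iUnion.2 ⟨(s, j), ?_⟩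
    simpa using hx
  · have h1 : tower (w j) (⋃ s, H s j) = ⋃ s, tower (sh s) (E s j) := by
      simp_rw [← hHt]
      ext x
      simp only [mem_tower, Set.mem_iUnion]
      constructor
      · rintro ⟨v, hv, y, ⟨s, hy⟩, e'⟩
        exact ⟨s, v, hv, y, hy, e'⟩
      · rintro ⟨s, v, hv, y, hy, e'⟩
        exact ⟨v, hv, y, ⟨s, hy⟩, e'⟩
    have h2 : μ (⋃ s, tower (sh s) (E s j)) = ∑' s, μ (tower (sh s) (E s j)) :=
      measure_iUnion (fun s s' hs => Set.disjoint_left.2 fun x hx hx' =>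
        hs (hdisj _ _ _ _ x hx hx').1) fun s => measurableSet_tower hT _ (hEm s j)
    have h3 : ∀ s, μ (tower (sh s) (E s j)) = ENNReal.ofReal (e s j) := fun s => by
      rw [← hEe, ofReal_measureReal]
    rw [h1, Measure.real, h2]
    simp_rw [h3]
    rw [← ENNReal.ofReal_tsum_of_nonneg (fun s => he s j) (hp j).summable, (hp j).tsum_eq,
      ENNReal.toReal_ofReal ((hp j).nonneg fun s => he s j)]

/-- The preceding lemma for tiles of finitely many shapes `w j`, `j ∈ J`, and cubes of sides
`N m`, where the cubes cover nearly everything needed for the shapes `w j` with `b j = m`. -/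
lemma exists_packing_of_cubes [IsProbabilityMeasure μ] (hd : 1 ≤ d) {ι : Type*}
    {w : ι → Fin d → ℕ} (hw : ∀ j i, 0 < w j i) {J : Finset ι} {j₀ : ι} (hj₀ : j₀ ∈ J)
    {N : ℕ → ℕ} (hN0 : ∀ m, 0 < N m) {b : ι → ℕ} {I : ℕ → Finset ι}
    (hI : ∀ m j, j ∈ I m ↔ b j = m) (hbJ : ∀ j ∈ J, b j = 0)
    (hN : ∀ j i, w j i ∣ N (b j)) (hNj₀ : ∀ m i, w j₀ i ∣ N m)
    (hT : ∀ v : Fin d → ℤ, MeasurePreserving (fun x : X => v +ᵥ x) μ μ)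
    {f : X → ℝ} (hf : Measurable f) (hfree : ∀ v : Fin d → ℤ, v ≠ 0 → ∀ᵐ x ∂μ, f (v +ᵥ x) ≠ f x)
    {G : J ⊕ ℕ → Set X} (hG : ∀ s, MeasurableSet (G s))
    (hpack : IsPacking (Sum.elim (fun j : J => w j) fun k _ => N k) G)
    (hcover : ∀ᵐ x ∂μ, x ∈ ⋃ s, tower
      ((Sum.elim (fun j : J => w j) fun k _ => N k : _ → Fin d → ℕ) s) (G s))
    {p : ι → ℝ} (hp : ∀ j, 0 ≤ p j) (hsum : HasSum (fun m => ∑ j ∈ I m, p j) 1) {δ : ℝ}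
    (hδ : ∀ j ∈ J, δ ≤ p j)
    (h0 : 1 - δ ≤ μ.real (tower (fun _ : Fin d => N 0) (G (Sum.inr 0))))
    (h1 : ∀ m, m ≠ 0 → ∑ j ∈ I m, p j ≤ μ.real (tower (fun _ : Fin d => N m) (G (Sum.inr m)))) :
    ∃ H : ι → Set X, (∀ j, MeasurableSet (H j)) ∧ IsPacking w H ∧
      ∀ j, μ.real (tower (w j) (H j)) = p j := by
  classical
  set sh : J ⊕ ℕ → Fin d → ℕ := Sum.elim (fun j : J => w j) fun k _ => N k with hsh
  have hm : ∀ s, MeasurableSet (tower (sh s) (G s)) := fun s => measurableSet_tower hT _ (hG s)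
  set q : ι → ℝ := fun j => if h : j ∈ J then μ.real (tower (w j) (G (Sum.inl ⟨j, h⟩))) else 0
    with hq
  set r : ℕ → ℝ := fun m => μ.real (tower (fun _ : Fin d => N m) (G (Sum.inr m))) with hr
  set Q : ℝ := ∑ j ∈ J, q j with hQ
  have hq0 : ∀ j, 0 ≤ q j := fun j => by
    simp only [hq]
    split_ifs
    exacts [measureReal_nonneg, le_rfl]
  have hqJ : ∀ j ∉ J, q j = 0 := fun j hj => by simp [hq, hj]
  have hqQ : ∀ j, q j ≤ Q := fun j => by
    by_cases hj : j ∈ J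
    · exact Finset.single_le_sum (fun j _ => hq0 j) hj
    · rw [hqJ j hj]; exact Finset.sum_nonneg fun j _ => hq0 j
  -- all measures add up to one
  have htotal : HasSum (fun s => μ.real (tower (sh s) (G s))) 1 := by
    have h2 : μ (⋃ s, tower (sh s) (G s)) = 1 := by
      rw [← measure_univ (μ := μ)]
      exact measure_congr (Filter.eventuallyEq_univ.2 hcover)
    rw [measure_iUnion (fun s s' hs => Set.disjoint_left.2 fun x hx hx' => by
      obtain ⟨u, hu, y, hy, rfl⟩ := mem_tower.1 hx
      obtain ⟨v, hv, z, hz, e'⟩ := mem_tower.1 hx'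
      exact hs (hpack s' z hz s y hy v hv u hu e').1.symm) hm] at h2
    have h3 := ENNReal.hasSum_toReal (h2 ▸ ENNReal.one_ne_top)
    rwa [show ∑' s, (μ (tower (sh s) (G s))).toReal = 1 by
      rw [← ENNReal.tsum_toReal_eq fun s => measure_ne_top _ _, h2]; rfl] at h3
  have hrsum : HasSum r (1 - Q) := by
    have hr' : Summable ((fun s => μ.real (tower (sh s) (G s))) ∘ Sum.inr) :=
      htotal.summable.comp_injective Sum.inr_injective
    have hrr : (fun s => μ.real (tower (sh s) (G s))) ∘ Sum.inr = r := rfl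
    have hl : HasSum ((fun s => μ.real (tower (sh s) (G s))) ∘ Sum.inl) Q := by
      rw [hQ, ← Finset.sum_attach]
      convert hasSum_fintype (fun j : J => q j) using 1
      · funext j
        simp [hq, hsh]
      · rw [Finset.univ_eq_attach]
    have h4 := htotal.unique (hl.sum hr'.hasSum)
    rw [hrr] at h4 hr'
    have h5 : ∑' m, r m = 1 - Q := by linarith
    exact h5 ▸ hr'.hasSum
  have hr0Q : Q ≤ δ := by
    have h2 := le_hasSum hrsum 0 fun m _ => measureReal_nonneg
    linarith [h0, h2]
  -- Surplus of the cubes of side `N m` over the demand of block `m`, where at `m = 0` the demand is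
  -- lowered by the measure `Q` already covered by tiles of shapes in `J`. Supply and demand are
  -- both `1`, so the surpluses add up to zero and giving all of them to `j₀` does not change its
  -- total.
  set x : ℕ → ℝ := fun m => r m - ∑ j ∈ I m, p j + if m = 0 then Q else 0 with hx
  have hxsum : HasSum x 0 := by
    have := (hrsum.sub hsum).add (hasSum_ite_eq 0 Q)
    rwa [show 1 - Q - 1 + Q = 0 by ring] at this
  let e : J ⊕ ℕ → ι → ℝ := fun s j => match s with
    | Sum.inl k => if j = k then q j else 0
    | Sum.inr m => (if m = b j then p j else 0) + (if j = j₀ then x m else 0) -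
        if m = 0 then q j else 0
  refine exists_packing_of_transport hd hw (sh := sh) ?_ hT hf hfree hG hpack (e := e) ?_
    (I := fun s => match s with
      | Sum.inl k => {k.1}
      | Sum.inr m => insert j₀ (I m)) ?_ ?_ ?_ ?_
  · rintro (j | m) i
    exacts [hw j i, hN0 m]
  · rintro (k | m) j
    · simp only [e]
      split_ifs
      exacts [hq0 j, le_rfl]
    · simp only [e]
      -- Only `m = 0` involves negative contributions. For `j ∈ J` one has `q j ≤ Q ≤ δ ≤ p j`; for
      -- `j₀` the possible deficit `x 0` is absorbed because `r 0 ≥ 1 - δ` and block `0` demands at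
      -- most `1`.
      rcases Nat.eq_zero_or_pos m with rfl | hmp
      · simp only [if_true]
        have hPle : ∑ j ∈ I 0, p j ≤ 1 := le_hasSum hsum 0 fun m _ =>
          Finset.sum_nonneg fun j _ => hp j
        by_cases hjJ : j ∈ J
        · rw [if_pos (hbJ j hjJ).symm]
          have h2 := hδ j hjJ
          have h3 := hqQ j
          split_ifs
          · simp only [hx, if_true]
            linarith [h0]
          · linarith
        · have h2 : j ≠ j₀ := fun h => hjJ (h ▸ hj₀)
          rw [hqJ j hjJ, if_neg h2]
          split_ifs
          · linarith [hp j]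
          · simp
      · have h2 : 0 ≤ x m := by
          simp only [hx, if_neg hmp.ne', add_zero]
          exact sub_nonneg.2 (h1 m hmp.ne')
        rw [if_neg hmp.ne', sub_zero]
        have := hp j
        split_ifs <;> linarith
  · rintro (k | m) j hj
    · simp only [Finset.mem_singleton] at hj
      simp [e, hj]
    · simp only [Finset.mem_insert, hI, not_or] at hj
      have hmb : m ≠ b j := fun h => hj.2 h.symm
      simp only [e, if_neg hmb, if_neg hj.1]
      rcases Nat.eq_zero_or_pos m with rfl | hmp
      · rw [hqJ j fun h => hj.2 (hbJ j h)]
        simp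
      · simp [hmp.ne']
  · rintro (k | m) j hj i
    · simp only [Finset.mem_singleton] at hj
      subst hj
      exact dvd_rfl
    · simp only [Finset.mem_insert, hI] at hj
      rcases hj with rfl | rfl
      exacts [hNj₀ m i, hN j i]
  · rintro (k | m)
    · simp [e, hq, hsh]
    · refine le_of_eq ?_
      have h2 : ∑ j ∈ insert j₀ (I m), (if m = b j then p j else 0) = ∑ j ∈ I m, p j := by
        rw [← Finset.sum_filter]
        refine Finset.sum_congr ?_ fun _ _ => rfl
        ext j
        simp only [Finset.mem_filter, Finset.mem_insert, hI]
        constructor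
        · exact fun h => h.2.symm
        · exact fun h => ⟨Or.inr h, h.symm⟩
      have h3 : ∑ j ∈ insert j₀ (I m), (if m = 0 then q j else 0) = if m = 0 then Q else 0 := by
        split_ifs with hm0
        · subst hm0
          refine (Finset.sum_subset (fun j hj => ?_) fun j _ hj => hqJ j hj).symm
          exact Finset.mem_insert_of_mem ((hI 0 j).2 (hbJ j hj))
        · simp
      simp only [e, Finset.sum_sub_distrib, Finset.sum_add_distrib, h2, h3]
      rw [Finset.sum_ite_eq' (insert j₀ (I m)) j₀ fun _ => x m, if_pos (Finset.mem_insert_self _ _)]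
      simp only [hx]
      change _ = r m
      ring
  · intro j
    have hl : HasSum ((fun s => e s j) ∘ Sum.inl) (q j) := by
      by_cases hj : j ∈ J
      · convert hasSum_ite_eq (⟨j, hj⟩ : J) (q j) using 1
        funext k
        simp only [e, Function.comp]
        congr 1
        exact propext ⟨fun h => Subtype.ext h.symm, fun h => by rw [h]⟩
      · rw [hqJ j hj]
        convert hasSum_zero using 1
        funext k
        simp only [e, Function.comp]
        exact if_neg fun h : j = k.1 => hj (h ▸ k.2)
    have hr' : HasSum ((fun s => e s j) ∘ Sum.inr) (p j + 0 - q j) := by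
      have h2 : HasSum (fun m => if j = j₀ then x m else 0) 0 := by
        split_ifs
        exacts [hxsum, hasSum_zero]
      exact ((hasSum_ite_eq (b j) (p j)).add h2).sub (hasSum_ite_eq 0 (q j))
    have := hl.sum hr'
    rwa [show q j + (p j + 0 - q j) = p j by ring] at this

end Retile

/-! ### Choice of shapes, blocks and cube sides -/

section Parameters

/-- In each coordinate finitely many sides generate every large multiple of the gcd; the union over
the `d` coordinates is still finite. -/
lemma exists_finset_closure_of_gcd {d : ℕ} {ι : Type*} [Nonempty ι] {w : ι → Fin d → ℕ}
    (hgcd : ∀ i : Fin d, ∀ n : ℕ, (∀ j, n ∣ w j i) → n = 1) :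
    ∃ J : Finset ι, J.Nonempty ∧ ∃ M : ℕ, ∀ i, ∀ n, M ≤ n →
      n ∈ AddSubmonoid.closure (Set.range fun j : J => w j i) := by
  classical
  have h : ∀ i : Fin d, ∃ (J : Finset ι) (M : ℕ), ∀ n, M ≤ n →
      n ∈ AddSubmonoid.closure ((fun j => w j i) '' J) := by
    intro i
    obtain ⟨t, n, hts, hn⟩ := Nat.exists_mem_span_nat_finset_of_ge (Set.range fun j => w j i)
    have h1 : Nat.setGcd (Set.range fun j => w j i) = 1 :=
      hgcd i _ fun j => Nat.setGcd_dvd_of_mem ⟨j, rfl⟩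
    choose! g hg using fun k (hk : k ∈ t) => hts hk
    refine ⟨t.image g, n, fun m hm => ?_⟩
    have h2 := (Submodule.span_nat_eq_addSubmonoidClosure (t : Set ℕ)).le
      (hn m hm (h1 ▸ one_dvd m))
    refine AddSubmonoid.closure_mono (fun k hk => ?_) h2
    exact ⟨g k, by simpa using ⟨k, hk, rfl⟩, hg k hk⟩
  choose J M hJ using h
  obtain ⟨j⟩ := ‹Nonempty ι›
  refine ⟨insert j (Finset.univ.biUnion J), Finset.insert_nonempty _ _, Finset.univ.sup M,
    fun i n hn => AddSubmonoid.closure_mono ?_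
      (hJ i n ((Finset.le_sup (Finset.mem_univ i)).trans hn))⟩
  rintro _ ⟨k, hk, rfl⟩
  exact ⟨⟨k, Finset.mem_insert_of_mem (Finset.mem_biUnion.2 ⟨i, Finset.mem_univ i, hk⟩)⟩, rfl⟩

/-- Finite blocks of indices such that the first `m + 1` of them carry all but `σ m` of a
probability vector. -/
lemma exists_blocks {ι : Type*} {p : ι → ℝ} (hp : ∀ j, 0 < p j) (hsum : HasSum p 1)
    (J : Finset ι) {σ : ℕ → ℝ} (hσ : ∀ m, 0 < σ m)
    (hσ0 : Filter.Tendsto σ Filter.atTop (nhds 0)) :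
    ∃ (b : ι → ℕ) (I : ℕ → Finset ι), (∀ m j, j ∈ I m ↔ b j = m) ∧ (∀ j ∈ J, b j = 0) ∧
      HasSum (fun m => ∑ j ∈ I m, p j) 1 ∧
      ∀ m, 1 - σ m ≤ ∑ k ∈ Finset.range (m + 1), ∑ j ∈ I k, p j := by
  classical
  have h : ∀ m, ∃ S : Finset ι, J ⊆ S ∧ 1 - σ m < ∑ j ∈ S, p j := fun m =>
    ((Filter.eventually_ge_atTop J).and
      (hsum.eventually (lt_mem_nhds (sub_lt_self 1 (hσ m))))).exists
  choose S hJS hS using h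
  -- An index outside `S m` has weight less than `σ m`, which tends to zero. The block of `j` is the
  -- first `m` with `j ∈ S m`.
  have hex : ∀ j, ∃ m, j ∈ S m := by
    intro j
    obtain ⟨m, hm⟩ := (hσ0.eventually (gt_mem_nhds (hp j))).exists
    refine ⟨m, by_contra fun hj => ?_⟩
    have h1 := sum_le_hasSum (insert j (S m)) (fun k _ => (hp k).le) hsum
    rw [Finset.sum_insert hj] at h1
    linarith [hS m]
  have hmem : ∀ m j, j ∈ (S m).filter (fun j => Nat.find (hex j) = m) ↔ Nat.find (hex j) = m := by
    intro m j
    rw [Finset.mem_filter]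
    exact ⟨fun h => h.2, fun h => ⟨h ▸ Nat.find_spec (hex j), h⟩⟩
  have hun : ∀ n, ∑ k ∈ Finset.range n, ∑ j ∈ (S k).filter (fun j => Nat.find (hex j) = k), p j =
      ∑ j ∈ (Finset.range n).biUnion fun k => (S k).filter (fun j => Nat.find (hex j) = k),
        p j := by
    intro n
    rw [Finset.sum_biUnion]
    intro k _ l _ hkl
    refine Finset.disjoint_left.2 fun j hj hj' => hkl ?_
    rw [hmem] at hj hj'
    exact hj.symm.trans hj'
  have hlow : ∀ m, 1 - σ m ≤
      ∑ k ∈ Finset.range (m + 1), ∑ j ∈ (S k).filter (fun j => Nat.find (hex j) = k), p j := by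
    intro m
    rw [hun]
    refine (hS m).le.trans (Finset.sum_le_sum_of_subset_of_nonneg (fun j hj => ?_)
      fun j _ _ => (hp j).le)
    exact Finset.mem_biUnion.2 ⟨Nat.find (hex j), Finset.mem_range.2
      (Nat.lt_succ_of_le (Nat.find_min' (hex j) hj)), (hmem _ _).2 rfl⟩
  refine ⟨fun j => Nat.find (hex j), _, hmem, fun j hj => ?_, ?_, hlow⟩
  · exact Nat.le_zero.1 (Nat.find_min' (hex j) (hJS 0 hj))
  · rw [hasSum_iff_tendsto_nat_of_nonneg fun m => Finset.sum_nonneg fun j _ => (hp j).le]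
    refine (Filter.tendsto_add_atTop_iff_nat 1).1 ?_
    refine tendsto_of_tendsto_of_tendsto_of_le_of_le (g := fun m => 1 - σ m) (h := fun _ => 1)
      ?_ tendsto_const_nhds hlow fun m => ?_
    · simpa using hσ0.const_sub 1
    · rw [hun]
      exact sum_le_hasSum _ (fun k _ => (hp k).le) hsum

lemma exists_dvd_le (D : ℕ) (hD : 0 < D) {ε : ℝ} (hε : 0 < ε) (A : ℝ) (a : ℕ) :
    ∃ n, 0 < n ∧ D ∣ n ∧ A ≤ ε * n ∧ a ≤ n := by
  obtain ⟨k, hk⟩ := exists_nat_ge (A / ε)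
  refine ⟨D * (k + a + 1), Nat.mul_pos hD (Nat.succ_pos _), dvd_mul_right _ _, ?_, by nlinarith⟩
  rw [div_le_iff₀ hε] at hk
  have h1 : (k : ℝ) ≤ ((D * (k + a + 1) : ℕ) : ℝ) := by
    exact_mod_cast (by nlinarith : k ≤ D * (k + a + 1))
  nlinarith

lemma exists_sides (d c : ℕ) {D : ℕ → ℕ} (hD : ∀ l, 0 < D l) {ε : ℕ → ℝ} (hε : ∀ l, 0 < ε l) :
    ∃ N : ℕ → ℕ, (∀ l, 0 < N l) ∧ (∀ l, D l ∣ N l) ∧ 8 * d * c ≤ ε 0 * N 0 ∧ 2 * c ≤ N 0 ∧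
      (∀ l, 8 * d * (c + N l : ℕ) ≤ ε (l + 1) * N (l + 1)) ∧
      ∀ l, 2 * (c + N l) ≤ N (l + 1) := by
  obtain ⟨N, hN, hN'⟩ := exists_seq_of_step
    (fun l n => 0 < n ∧ D l ∣ n ∧ (l = 0 → 8 * d * c ≤ ε 0 * n ∧ 2 * c ≤ n))
    (fun l n n' => 8 * d * (c + n : ℕ) ≤ ε (l + 1) * n' ∧ 2 * (c + n) ≤ n')
    (by
      obtain ⟨n, h1, h2, h3, h4⟩ := exists_dvd_le (D 0) (hD 0) (hε 0) (8 * d * c) (2 * c)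
      exact ⟨n, h1, h2, fun _ => ⟨h3, h4⟩⟩)
    (by
      rintro l n -
      obtain ⟨n', h1, h2, h3, h4⟩ := exists_dvd_le (D (l + 1)) (hD _) (hε (l + 1))
        (8 * d * (c + n : ℕ)) (2 * (c + n))
      exact ⟨n', ⟨h1, h2, fun h => by omega⟩, h3, h4⟩)
  exact ⟨N, fun l => (hN l).1, fun l => (hN l).2.1, ((hN 0).2.2 rfl).1, ((hN 0).2.2 rfl).2,
    fun l => (hN' l).1, fun l => (hN' l).2⟩

end Parameters

/-! ### Retiling an invariant set by choice of orbit representatives -/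

/-- Invariant sets on which the action is free can be tiled by copies of one rectangle, without
any measurability. -/
lemma exists_isTiling_of_invariant {d : ℕ} {X : Type*} [AddAction (Fin d → ℤ) X]
    {ι : Type*} {w : ι → Fin d → ℕ} (hw : ∀ j i, 0 < w j i) (j : ι) {A : Set X}
    (hA : ∀ v : Fin d → ℤ, ∀ x ∈ A, v +ᵥ x ∈ A)
    (hfree : ∀ v : Fin d → ℤ, v ≠ 0 → ∀ x : X, v +ᵥ x ≠ x) :
    ∃ Z, IsTiling w Z A := by
  obtain ⟨t, ht⟩ := exists_isTiling_of_saturated hw j 0 (A := Set.univ)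
    fun _ _ _ _ => Set.mem_univ _
  -- A chosen point of each orbit identifies the orbit with `ℤ ^ d`, where a single periodic tiling
  -- is copied.
  let rep : X → X := fun x => (Quotient.mk (AddAction.orbitRel (Fin d → ℤ) X) x).out
  have hrep : ∀ x, ∃ v : Fin d → ℤ, v +ᵥ rep x = x := by
    intro x
    have h1 : (AddAction.orbitRel (Fin d → ℤ) X).r (rep x) x := Quotient.mk_out x
    obtain ⟨v, hv⟩ := AddAction.mem_orbit_iff.1 (AddAction.orbitRel_apply.1 h1)
    exact ⟨-v, by rw [← hv, neg_vadd_vadd]⟩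
  have hrepv : ∀ (v : Fin d → ℤ) x, rep (v +ᵥ x) = rep x := fun v x =>
    congrArg Quotient.out (Quotient.sound (s := AddAction.orbitRel (Fin d → ℤ) X)
      (AddAction.orbitRel_apply.2 ⟨v, rfl⟩))
  have hinj : ∀ x : X, Set.InjOn (fun v : Fin d → ℤ => v +ᵥ x) Set.univ := by
    intro x u _ v _ e
    by_contra huv
    refine hfree (-v + u) (fun h => huv (by rw [neg_add_eq_zero] at h; exact h.symm)) x ?_
    have e' : u +ᵥ x = v +ᵥ x := e
    rw [add_vadd, e', neg_vadd_vadd]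
  refine ⟨_, (isTiling_iUnion (I := {x : X // x ∈ A ∧ rep x = x}) (sh := w)
    (fun x => ht.vadd_image (hinj x.1)) ?_).of_eq ?_⟩
  · rintro ⟨x, hxA, hx⟩ ⟨y, hyA, hy⟩ _ ⟨u, -, rfl⟩ ⟨v, -, e⟩
    have h1 := congrArg rep e
    simp only [hrepv] at h1
    exact Subtype.ext (hx.symm.trans (h1.symm.trans hy))
  · ext x
    simp only [Set.mem_iUnion, Set.image_univ, Set.mem_range, Subtype.exists, exists_prop]
    constructor
    · intro hx
      obtain ⟨v, hv⟩ := hrep x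
      refine ⟨rep x, ⟨?_, ?_⟩, v, hv⟩
      · have h2 : rep x = -v +ᵥ x := vadd_left_cancel v (by rw [vadd_neg_vadd]; exact hv)
        exact h2 ▸ hA _ _ hx
      · have h2 := hrepv v (rep x)
        rw [hv] at h2
        exact h2.symm
    · rintro ⟨y, ⟨hy, -⟩, v, rfl⟩
      exact hA v y hy

/-! ### Assembly of the theorem -/

section Main

variable {d : ℕ} {X : Type*} [MeasurableSpace X] {μ : Measure X} [AddAction (Fin d → ℤ) X]

/-- The isomorphism modulo null sets has a left inverse almost everywhere, so it separates almost
every point from its translates. This function and completeness are all that is used of the Lebesgue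
space structure. -/
lemma IsLebesgueProbabilitySpace.exists_measurable_real (hμ : IsLebesgueProbabilitySpace μ)
    (hT : ∀ v : Fin d → ℤ, MeasurePreserving (fun x : X => v +ᵥ x) μ μ)
    (hfree : ∀ v : Fin d → ℤ, v ≠ 0 → ∀ᵐ x ∂μ, v +ᵥ x ≠ x) :
    ∃ f : X → ℝ, Measurable f ∧ ∀ v : Fin d → ℤ, v ≠ 0 → ∀ᵐ x ∂μ, f (v +ᵥ x) ≠ f x := by
  obtain ⟨ν, -, f, g, hf, -, hgf, -⟩ := hμ.exists_iso_mod_zero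
  refine ⟨f, fun s hs => hf.measurable hs.nullMeasurableSet, fun v hv => ?_⟩
  filter_upwards [hgf, (hT v).quasiMeasurePreserving.ae hgf, hfree v hv] with x h1 h2 h3 h4
  exact h3 ((h2.symm.trans (congrArg g h4)).trans h1)

/-- The tower theorem up to null sets. -/
lemma exists_packing_measureReal_eq [IsProbabilityMeasure μ] (hd : 1 ≤ d) {ι : Type*}
    {w : ι → Fin d → ℕ} (hw : ∀ j i, 0 < w j i)
    (hgcd : ∀ i : Fin d, ∀ n : ℕ, (∀ j, n ∣ w j i) → n = 1)
    {p : ι → ℝ} (hp : ∀ j, 0 < p j) (hsum : HasSum p 1)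
    (hT : ∀ v : Fin d → ℤ, MeasurePreserving (fun x : X => v +ᵥ x) μ μ)
    {f : X → ℝ} (hf : Measurable f)
    (hfree : ∀ v : Fin d → ℤ, v ≠ 0 → ∀ᵐ x ∂μ, f (v +ᵥ x) ≠ f x) :
    ∃ H : ι → Set X, (∀ j, MeasurableSet (H j)) ∧ IsPacking w H ∧
      ∀ j, μ.real (tower (w j) (H j)) = p j := by
  classical
  have : Nonempty ι := by
    by_contra h
    rw [not_nonempty_iff] at h
    exact one_ne_zero (hsum.unique hasSum_empty)
  obtain ⟨J, ⟨j₀, hj₀⟩, M, hM⟩ := exists_finset_closure_of_gcd hgcd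
  obtain ⟨δ, hδ0, hδ⟩ : ∃ δ : ℝ, 0 < δ ∧ ∀ j ∈ J, δ ≤ p j := by
    obtain ⟨j, -, hj⟩ := J.exists_min_image p ⟨j₀, hj₀⟩
    exact ⟨p j, hp j, hj⟩
  have hδ1 : δ ≤ 1 := (hδ j₀ hj₀).trans (le_hasSum hsum j₀ fun j _ => (hp j).le)
  -- Geometric errors with ratio `1 / 8`: the sum of all errors after stage `m` is only `σ m / 7`.
  set σ : ℕ → ℝ := fun m => δ / 8 * (1 / 8) ^ m with hσ
  have hσpos : ∀ m, 0 < σ m := fun m => by positivity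
  have hσle : ∀ m, σ m ≤ 1 / 8 := fun m => by
    have h1 : ((1 : ℝ) / 8) ^ m ≤ 1 := pow_le_one₀ (by norm_num) (by norm_num)
    simp only [hσ]
    nlinarith
  have hσ0 : Filter.Tendsto σ Filter.atTop (nhds 0) := by
    have h1 := (tendsto_pow_atTop_nhds_zero_of_lt_one (r := (1 / 8 : ℝ)) (by norm_num)
      (by norm_num)).const_mul (δ / 8)
    rwa [mul_zero] at h1
  obtain ⟨b, I, hI, hbJ, hP, hPlow⟩ := exists_blocks hp hsum J (σ := fun m => σ m / 4)
    (fun m => by have := hσpos m; positivity) (by simpa using hσ0.div_const 4)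
  set P : ℕ → ℝ := fun m => ∑ j ∈ I m, p j with hPdef
  have hP0 : ∀ m, 0 ≤ P m := fun m => Finset.sum_nonneg fun j _ => (hp j).le
  have htail : ∀ m, HasSum (fun l => P (l + m + 1)) (1 - ∑ k ∈ Finset.range (m + 1), P k) :=
    fun m => by simpa only [add_assoc] using (hasSum_nat_add_iff' (m + 1)).2 hP
  have hgeom : ∀ m, HasSum (fun l => σ (l + m + 1)) (σ m / 7) := by
    intro m
    have h1 := (hasSum_geometric_of_lt_one (r := (1 / 8 : ℝ)) (by norm_num)
      (by norm_num)).mul_left (σ m / 8)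
    have h2 : (fun l => σ (l + m + 1)) = fun l => σ m / 8 * (1 / 8) ^ l := by
      funext l
      simp only [hσ, pow_add]
      ring
    rwa [h2, show σ m / 7 = σ m / 8 * (1 - 1 / 8)⁻¹ by ring]
  -- For `m ≥ 1` the reserve is the demand of block `m` plus `σ m` for later losses. At `m = 0`
  -- nearly everything is reserved.
  let ρ : ℕ → ℝ := fun m => if m = 0 then 1 - σ 0 else P m + σ m
  have hβsum : ∀ m, HasSum (fun l => σ (l + m + 1) + ρ (l + m + 1))
      (σ m / 7 + ((1 - ∑ k ∈ Finset.range (m + 1), P k) + σ m / 7)) := fun m =>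
    (hgeom m).add ((htail m).add (hgeom m))
  have hPle : ∀ m, P (m + 1) ≤ 1 / 2 := fun m => by
    have h1 := le_hasSum (htail m) 0 fun l _ => hP0 _
    have h2 := hPlow m
    have h3 := hσle m
    simp only [zero_add] at h1
    linarith
  -- the sides of the cubes
  set K : ℕ := ∏ j ∈ J, ∏ i, w j i with hK
  have hK0 : 0 < K := Finset.prod_pos fun j _ => Finset.prod_pos fun i _ => hw j i
  have hKd : ∀ (j : J) i, w j i ∣ K := fun j i =>
    (Finset.dvd_prod_of_mem (w j) (Finset.mem_univ i)).trans
      (Finset.dvd_prod_of_mem (fun j => ∏ i, w j i) j.2)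
  set c : ℕ := K * (2 * M + 2) + M with hc
  obtain ⟨N, hN0, hND, hNε₀, hcN₀, hNε, hcN⟩ := exists_sides d c
    (D := fun m => K * ∏ j ∈ I m, ∏ i, w j i)
    (fun m => Nat.mul_pos hK0 (Finset.prod_pos fun j _ => Finset.prod_pos fun i _ => hw j i)) hσpos
  have hKN : ∀ m, K ∣ N m := fun m => (dvd_mul_right _ _).trans (hND m)
  have hwN : ∀ j i, w j i ∣ N (b j) := fun j i =>
    (Finset.dvd_prod_of_mem (w j) (Finset.mem_univ i)).trans <|
      (Finset.dvd_prod_of_mem (fun j => ∏ i, w j i) ((hI (b j) j).2 rfl)).trans <|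
        (dvd_mul_left _ _).trans (hND (b j))
  have : Nonempty J := ⟨⟨j₀, hj₀⟩⟩
  obtain ⟨G, hG, hpack, hcover, hlow⟩ := exists_packing_cubes hd (w := fun j : J => w j) hT hf hfree
    hN0 (fun l P hP hPP => exists_isTiling_gap (w := fun j : J => w j)
      (fun j i => hw j i) hK0 hKd hM (hKN (l + 1)) (hKN l)
      le_rfl hP hPP) (ρ := ρ) hσpos (fun m => by
      have := hσle 0
      have := hσpos m
      have := hP0 m
      simp only [ρ]
      split_ifs <;> linarith) (fun m => by
      rcases m with _ | m
      · simp [ρ]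
      · have := hσle (m + 1)
        have := hPle m
        simp only [ρ, Nat.succ_ne_zero, if_false]
        linarith) hNε₀ hcN₀ hNε hcN (hβsum 0).summable
  -- Later stages destroy at most `2 * (σ m / 7)` for the errors plus the demand `σ m / 4` of the
  -- later blocks, less than `σ m` together.
  have hlow' : ∀ m, ρ m - σ m ≤ μ.real (tower (fun _ : Fin d => N m) (G (Sum.inr m))) := by
    intro m
    refine le_trans ?_ (hlow m)
    rw [(hβsum m).tsum_eq]
    linarith [hPlow m, hσpos m]
  refine exists_packing_of_cubes hd hw hj₀ hN0 hI hbJ hwN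
    (fun m i => (hKd ⟨j₀, hj₀⟩ i).trans (hKN m))
    hT hf hfree hG hpack hcover (fun j => (hp j).le) hP hδ ?_ fun m hm => ?_
  · refine le_trans ?_ (hlow' 0)
    simp only [ρ, if_true, hσ, pow_zero]
    linarith
  · refine le_trans (le_of_eq ?_) (hlow' m)
    simp only [ρ, if_neg hm, hPdef]
    ring

/-- A packing can be changed on a null set so as to cover the space if the action is free. -/
lemma exists_packing_iUnion_eq_univ [IsProbabilityMeasure μ] [μ.IsComplete] {ι : Type*}
    [Countable ι] {w : ι → Fin d → ℕ} (hw : ∀ j i, 0 < w j i) {p : ι → ℝ} (hp : ∀ j, 0 < p j)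
    (hsum : HasSum p 1)
    (hT : ∀ v : Fin d → ℤ, MeasurePreserving (fun x : X => v +ᵥ x) μ μ)
    {H : ι → Set X} (hH : ∀ j, MeasurableSet (H j)) (hpack : IsPacking w H)
    (hHp : ∀ j, μ.real (tower (w j) (H j)) = p j) :
    ∃ H' : ι → Set X, (∀ j, MeasurableSet (H' j)) ∧ IsPacking w H' ∧
      (∀ j, μ (tower (w j) (H' j)) = ENNReal.ofReal (p j)) ∧
      (∀ᵐ x ∂μ, x ∈ ⋃ j, tower (w j) (H' j)) ∧
      ((∀ v : Fin d → ℤ, v ≠ 0 → ∀ x : X, v +ᵥ x ≠ x) → ⋃ j, tower (w j) (H' j) = Set.univ) := by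
  have hm : ∀ j, MeasurableSet (tower (w j) (H j)) := fun j => measurableSet_tower hT _ (hH j)
  have hHμ : ∀ j, μ (tower (w j) (H j)) = ENNReal.ofReal (p j) := fun j => by
    rw [← hHp, ofReal_measureReal]
  have hcover : ∀ᵐ x ∂μ, x ∈ ⋃ j, tower (w j) (H j) := by
    refine (prob_compl_eq_zero_iff (MeasurableSet.iUnion hm)).2 ?_
    rw [measure_iUnion (fun j k hjk => Set.disjoint_left.2 fun x hx hx' => by
      obtain ⟨u, hu, y, hy, rfl⟩ := mem_tower.1 hx
      obtain ⟨v, hv, z, hz, e⟩ := mem_tower.1 hx'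
      exact hjk (hpack k z hz j y hy v hv u hu e).1.symm) hm]
    simp_rw [hHμ]
    rw [← ENNReal.ofReal_tsum_of_nonneg (fun j => (hp j).le) hsum.summable, hsum.tsum_eq,
      ENNReal.ofReal_one]
  by_cases hfree : ∀ v : Fin d → ℤ, v ≠ 0 → ∀ x : X, v +ᵥ x ≠ x
  swap
  · exact ⟨H, hH, hpack, hHμ, hcover, fun h => (hfree h).elim⟩
  have : Nonempty ι := by
    by_contra h
    rw [not_nonempty_iff] at h
    exact one_ne_zero (hsum.unique hasSum_empty)
  obtain ⟨j₀⟩ := this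
  -- The points whose orbit is not entirely covered: an invariant null set, all of whose subsets are
  -- measurable by completeness. Invariance ensures that removing `N` from the bases removes whole
  -- tiles.
  let N : Set X := {x | ∃ v : Fin d → ℤ, v +ᵥ x ∉ ⋃ j, tower (w j) (H j)}
  have hNinv : ∀ v : Fin d → ℤ, ∀ x ∈ N, v +ᵥ x ∈ N := by
    rintro v x ⟨u, hu⟩
    exact ⟨u - v, by rwa [← add_vadd, sub_add_cancel]⟩
  have hN0 : μ N = 0 := by
    have h1 : ∀ᵐ x ∂μ, ∀ v : Fin d → ℤ, v +ᵥ x ∈ ⋃ j, tower (w j) (H j) :=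
      ae_all_iff.2 fun v => (hT v).quasiMeasurePreserving.ae hcover
    refine measure_mono_null ?_ h1
    rintro x ⟨v, hv⟩ h
    exact hv (h v)
  have hnull : ∀ A ⊆ N, MeasurableSet A := fun A hA =>
    Measure.IsComplete.out' A (measure_mono_null hA hN0)
  obtain ⟨Z, hZ⟩ := exists_isTiling_of_invariant hw j₀ hNinv hfree
  have hsub : ∀ {F : ι → Set X} {A : Set X}, IsTiling w F A → ∀ j, F j ⊆ A := fun h j x hx =>
    h.mem_iff.2 ⟨j, 0, zero_mem_latticeRectangle (hw j), x, hx, zero_vadd _ _⟩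
  have hrest : IsTiling w (fun j => H j \ N) Nᶜ := by
    refine isTiling_of_mem_iff (hpack.anti fun j => Set.sdiff_subset) fun x => ?_
    constructor
    · intro hx
      have h1 : x ∈ ⋃ j, tower (w j) (H j) := by
        by_contra h
        exact hx ⟨0, by rwa [zero_vadd]⟩
      obtain ⟨j, hj⟩ := Set.mem_iUnion.1 h1
      obtain ⟨u, hu, y, hy, rfl⟩ := mem_tower.1 hj
      exact ⟨j, u, hu, y, ⟨hy, fun h => hx (hNinv u y h)⟩, rfl⟩
    · rintro ⟨j, u, hu, y, ⟨-, hy⟩, rfl⟩ h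
      exact hy (by simpa using hNinv (-u) _ h)
  have hall := (hrest.union hZ disjoint_compl_left).of_eq (B := Set.univ)
    (Set.compl_union_self N).symm
  refine ⟨_, fun j => ((hH j).diff (hnull N le_rfl)).union (hnull _ (hsub hZ j)), hall.packing,
    fun j => ?_, ?_, fun _ => hall.cover⟩
  · rw [← hHμ]
    have hNae : ∀ᵐ x ∂μ, x ∉ N := measure_eq_zero_iff_ae_notMem.1 hN0
    refine measure_congr ?_
    filter_upwards [hNae] with x hx
    refine propext (show x ∈ tower (w j) _ ↔ x ∈ tower (w j) _ from ?_)
    simp only [mem_tower]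
    constructor
    · rintro ⟨u, hu, y, hy | hy, rfl⟩
      · exact ⟨u, hu, y, hy.1, rfl⟩
      · exact (hx (hNinv u y (hsub hZ j hy))).elim
    · rintro ⟨u, hu, y, hy, rfl⟩
      exact ⟨u, hu, y, Or.inl ⟨hy, fun h => hx (hNinv u y h)⟩, rfl⟩
  · rw [hall.cover]
    exact Filter.Eventually.of_forall fun x => Set.mem_univ x

end Main

theorem theorem1 {d : ℕ} (hd : 1 ≤ d) {ι : Type*} [Countable ι]
    (w : ι → Fin d → ℕ) (hw : ∀ j i, 0 < w j i)
    (hgcd : ∀ i : Fin d, ∀ n : ℕ, (∀ j, n ∣ w j i) → n = 1)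
    (p : ι → ℝ) (hp : ∀ j, 0 < p j) (hsum : HasSum p 1)
    {X : Type*} [MeasurableSpace X] (μ : Measure X) (hμ : IsLebesgueProbabilitySpace μ)
    [AddAction (Fin d → ℤ) X]
    (hpres : ∀ v : Fin d → ℤ, MeasurePreserving (fun x : X => v +ᵥ x) μ μ)
    (hfree : ∀ v : Fin d → ℤ, v ≠ 0 → ∀ᵐ x ∂μ, v +ᵥ x ≠ x) :
    ∃ τ : ι → Set X,
      (∀ j, IsRohlinTower (w j) (τ j)) ∧
      (∀ j, μ (τ j) = ENNReal.ofReal (p j)) ∧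
      (∀ j j', j ≠ j' → Disjoint (τ j) (τ j')) ∧
      (∀ᵐ x ∂μ, x ∈ ⋃ j, τ j) ∧
      ((∀ v : Fin d → ℤ, v ≠ 0 → ∀ x : X, v +ᵥ x ≠ x) → ⋃ j, τ j = Set.univ) := by
  have := hμ.isProbabilityMeasure
  have := hμ.isComplete
  obtain ⟨f, hf, hff⟩ := hμ.exists_measurable_real hpres hfree
  obtain ⟨H, hH, hpack, hHp⟩ := exists_packing_measureReal_eq hd hw hgcd hp hsum hpres hf hff
  obtain ⟨H', hH', hpack', hHp', hcover, huniv⟩ :=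
    exists_packing_iUnion_eq_univ hw hp hsum hpres hH hpack hHp
  refine ⟨fun j => tower (w j) (H' j), fun j => ⟨H' j, hH' j, fun u hu v hv huv => ?_, rfl⟩, hHp',
    fun j k hjk => ?_, hcover, huniv⟩
  · refine Set.disjoint_left.2 ?_
    rintro _ ⟨x, hx, rfl⟩ ⟨y, hy, e⟩
    exact huv (hpack' j y hy j x hx v hv u hu e).2.symm
  · refine Set.disjoint_left.2 fun x hx hx' => ?_
    obtain ⟨u, hu, y, hy, rfl⟩ := mem_tower.1 hx
    obtain ⟨v, hv, z, hz, e⟩ := mem_tower.1 hx'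
    exact hjk (hpack' k z hz j y hy v hv u hu e).1.symm
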